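/- A \emph{(finite) triangulated $2$-manifold, possibly with boundary,} is obtained from $n$ topological triangles by gluing some of their sides together in pairs; sides that are not glued form the boundary. It need not be orientable and need not be a simplicial complex: two triangles may share several vertices or edges, and two sides of one triangle may be glued to each other. Suppose that every triangle is given a nondegenerate Euclidean shape by its three side lengths (sides that are glued together normally have equal lengths, but this is not needed) and an orientation by the order of its corners. A \emph{vertex-unfolding} of $\mathcal M$ is a placement in the plane of all its triangles, each whole and congruent to its given shape with the given orientation (so that $\mathcal M$ is cut only along edges), such that different triangles have disjoint interiors, and such that the layout is connected in the following sense: call two triangles \emph{joined} if some corner of the one and some corner of the other are the same vertex of $\mathcal M$ and are placed at the same point of the plane; then any two triangles are linked by a chain of successively joined triangles. (In particular, triangles may be joined only at vertices and not along edges.) \textbf{Theorem.} Every connected triangulated $2$-manifold, possibly with boundary, has a vertex-unfolding, for all shapes and orientations of its triangles. Moreover, a vertex-unfolding can be computed in linear time: there are a fixed program of a real random access machine and a constant $C$ such that, for every connected triangulated $2$-manifold with $n$ triangles and all shapes, the program, given $n$, the table of the gluings of the $3n$ sides and the table of the $3n$ side lengths, halts after at most $Cn$ steps with the coordinates of the corners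 of all triangles in a vertex-unfolding as its output. Here the unit-cost operations are reading and writing of memory cells with computed addresses, addition, (truncated) subtraction and comparison of natural numbers, and $+,-,\times,/,\sqrt{\phantom{x}}$ and comparison of exact real numbers; all natural numbers that the program stores and all addresses that it writes to are at most $Cn$. -/

import Mathlib

noncomputable section

namespace VertexUnfolding

/-! ### Triangulated surfaces -/

/-- A (finite) triangulated 2-manifold, possibly with boundary, made of `n` triangles.
Each triangle `t` has corners `0, 1, 2`; its side `(t, s)` runs from corner `s` to corner `s + 1`
(indices modulo 3).  Some sides are glued in pairs: `mate e` is the side glued to `e`, and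
`mate e = e` says that `e` is a boundary side.  `reversed e` records how `e` is glued to `mate e`:
if it is `true`, the start of `e` goes to the end of `mate e` and vice versa, if it is `false`,
start goes to start and end to end.

Nothing else is required: two triangles may share several sides or vertices, two sides of one
triangle may be glued together, the surface need not be orientable.  The space obtained by gluing
triangles along sides in pairs is always a compact 2-manifold with boundary (the link of a vertex is
a circle or an arc), and every compact 2-manifold constructed from triangles arises in this way. -/
structure TriangulatedSurface (n : ℕ) where
  mate : Fin n × Fin 3 → Fin n × Fin 3
  reversed : Fin n × Fin 3 → Bool
  mate_mate : ∀ e, mate (mate e) = e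
  reversed_mate : ∀ e, reversed (mate e) = reversed e
  reversed_boundary : ∀ e, mate e = e → reversed e = false

namespace TriangulatedSurface

variable {n : ℕ} (M : TriangulatedSurface n)

/-- The identifications made by the gluing.  A point of the disjoint union of the triangles is a
pair of a triangle and a triple of barycentric coordinates; the points of side `s` are those whose
coordinate at the opposite corner `s + 2` is zero. -/
def Glued (p q : Fin n × stdSimplex ℝ (Fin 3)) : Prop :=
  ∃ s s' : Fin 3, M.mate (p.1, s) = (q.1, s') ∧ p.2.1 (s + 2) = 0 ∧ q.2.1 (s' + 2) = 0 ∧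
    if M.reversed (p.1, s) = true then
      q.2.1 s' = p.2.1 (s + 1) ∧ q.2.1 (s' + 1) = p.2.1 s
    else
      q.2.1 s' = p.2.1 s ∧ q.2.1 (s' + 1) = p.2.1 (s + 1)

/-- The underlying topological space of the surface: the disjoint union of the triangles modulo the
equivalence relation generated by the gluing. -/
def Space : Type := Quot M.Glued

instance : TopologicalSpace M.Space :=
  inferInstanceAs (TopologicalSpace (Quot M.Glued))

/-- The vertex of the surface represented by corner `i` of the triangle `t`. -/
def vertex (t : Fin n) (i : Fin 3) : M.Space :=
  Quot.mk _ (t, ⟨Pi.single i 1, single_mem_stdSimplex ℝ i⟩)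

end TriangulatedSurface

/-- The Euclidean shapes of the triangles: `len t s` is the length of side `s` of the triangle `t`.
The strict triangle inequalities say exactly that there is a nondegenerate Euclidean triangle with
these side lengths (in particular, they imply that the lengths are positive).  Sides that are glued
together are not required to have the same length, so this includes all polyhedral surfaces. -/
structure TriangleShapes (n : ℕ) where
  len : Fin n → Fin 3 → ℝ
  triangle_ineq : ∀ t s, len t s < len t (s + 1) + len t (s + 2)

/-! ### Vertex-unfoldings -/

/-- A planar layout of `n` triangles: the position of every corner of every triangle. -/
abbrev Layout (n : ℕ) : Type := Fin n → Fin 3 → EuclideanSpace ℝ (Fin 2)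

namespace Layout

variable {n : ℕ}

/-- The closed planar triangle occupied by `t`. -/
def tri (P : Layout n) (t : Fin n) : Set (EuclideanSpace ℝ (Fin 2)) :=
  convexHull ℝ (Set.range (P t))

/-- Two triangles are joined in a layout of the surface `M` if they have a common vertex in `M` that
also is a common vertex of theirs in the layout.  (Triangles that are joined along a common edge
have this property.  Triangles that only happen to touch in the plane do not.) -/
def Joined (M : TriangulatedSurface n) (P : Layout n) (t t' : Fin n) : Prop :=
  ∃ i i' : Fin 3, M.vertex t i = M.vertex t' i' ∧ P t i = P t' i'

end Layout

/-- `P` is a vertex-unfolding of the surface `M` whose triangles have the shapes `S`: the surface is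
cut along edges only, that is, the triangles are laid out whole and undistorted; they do not
overlap; and they hang together at common vertices. -/
structure IsVertexUnfolding {n : ℕ} (M : TriangulatedSurface n) (S : TriangleShapes n)
    (P : Layout n) : Prop where
  /-- Every triangle is laid out with its given side lengths. -/
  congruent : ∀ t s, dist (P t s) (P t (s + 1)) = S.len t s
  /-- No triangle is turned over: the corners `0, 1, 2` are in counterclockwise order. -/
  counterclockwise : ∀ t,
    0 < (P t 1 0 - P t 0 0) * (P t 2 1 - P t 0 1) - (P t 1 1 - P t 0 1) * (P t 2 0 - P t 0 0)
  /-- Different triangles do not overlap. -/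
  nonoverlapping : ∀ t t', t ≠ t' → Disjoint (interior (P.tri t)) (interior (P.tri t'))
  /-- The layout is connected through common vertices. -/
  connected : ∀ t t', Relation.ReflTransGen (P.Joined M) t t'

/-! ### The real RAM -/

/-- The memory of a real random access machine: arrays of natural numbers and arrays of real
numbers, both with names `0, 1, 2, …` (a program mentions finitely many names only) and with cells
`0, 1, 2, …`. -/
structure Mem where
  nat : ℕ → ℕ → ℕ
  real : ℕ → ℕ → ℝ

/-- Write `v` to cell `i` of the array `a` of natural numbers. -/
def Mem.setNat (m : Mem) (a i v : ℕ) : Mem :=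
  { m with nat := fun b j => if b = a ∧ j = i then v else m.nat b j }

/-- Write `x` to cell `i` of the array `a` of real numbers. -/
def Mem.setReal (m : Mem) (a i : ℕ) (x : ℝ) : Mem :=
  { m with real := fun b j => if b = a ∧ j = i then x else m.real b j }

/-- Integer expressions; `load a i` is the content of cell `i` of array `a`. -/
inductive NatExp where
  | const (c : ℕ)
  | load (a : ℕ) (i : NatExp)
  | add (e f : NatExp)
  | sub (e f : NatExp)

/-- The value of an integer expression (subtraction is truncated at zero). -/
def NatExp.eval (m : Mem) : NatExp → ℕ
  | const c => c
  | load a i => m.nat a (i.eval m)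
  | add e f => e.eval m + f.eval m
  | sub e f => e.eval m - f.eval m

/-- The number of unit-cost operations in the evaluation of an integer expression. -/
def NatExp.cost : NatExp → ℕ
  | const _ => 1
  | load _ i => i.cost + 1
  | add e f => e.cost + f.cost + 1
  | sub e f => e.cost + f.cost + 1

/-- Real expressions, over the operations `+`, `-`, `*`, `/` and square root.
The only constants are natural numbers. -/
inductive RealExp where
  | const (c : ℕ)
  | load (a : ℕ) (i : NatExp)
  | add (e f : RealExp)
  | sub (e f : RealExp)
  | mul (e f : RealExp)
  | div (e f : RealExp)
  | sqrt (e : RealExp)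

/-- The value of a real expression (division by zero and the square root of a negative number
give zero). -/
def RealExp.eval (m : Mem) : RealExp → ℝ
  | const c => c
  | load a i => m.real a (i.eval m)
  | add e f => e.eval m + f.eval m
  | sub e f => e.eval m - f.eval m
  | mul e f => e.eval m * f.eval m
  | div e f => e.eval m / f.eval m
  | sqrt e => Real.sqrt (e.eval m)

/-- The number of unit-cost operations in the evaluation of a real expression. -/
def RealExp.cost : RealExp → ℕ
  | const _ => 1
  | load _ i => i.cost + 1
  | add e f => e.cost + f.cost + 1
  | sub e f => e.cost + f.cost + 1
  | mul e f => e.cost + f.cost + 1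
  | div e f => e.cost + f.cost + 1
  | sqrt e => e.cost + 1

/-- Tests. -/
inductive Test where
  | natLe (e f : NatExp)
  | realLe (e f : RealExp)
  | not (b : Test)
  | and (b c : Test)

/-- The truth of a test. -/
def Test.Holds (m : Mem) : Test → Prop
  | natLe e f => e.eval m ≤ f.eval m
  | realLe e f => e.eval m ≤ f.eval m
  | not b => ¬ b.Holds m
  | and b c => b.Holds m ∧ c.Holds m

/-- The number of unit-cost operations in the evaluation of a test. -/
def Test.cost : Test → ℕ
  | natLe e f => e.cost + f.cost + 1
  | realLe e f => e.cost + f.cost + 1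
  | not b => b.cost + 1
  | and b c => b.cost + c.cost + 1

/-- Programs of the real random access machine.  `setNat a i e` and `setReal a i e` assign the
value of `e` to cell `i` of array `a`. -/
inductive Program where
  | skip
  | setNat (a : ℕ) (i : NatExp) (e : NatExp)
  | setReal (a : ℕ) (i : NatExp) (e : RealExp)
  | seq (p q : Program)
  | ite (b : Test) (p q : Program)
  | while (b : Test) (p : Program)

/-- `Exec W p m m' T`: the program `p`, started with memory `m`, halts with memory `m'` after `T`
steps.  Integers are machine words: only cells with address at most `W` are written to, and only
natural numbers up to `W` are stored. -/
inductive Exec (W : ℕ) : Program → Mem → Mem → ℕ → Prop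
  | skip (m : Mem) : Exec W .skip m m 1
  | setNat (m : Mem) (a : ℕ) (i e : NatExp) (hi : i.eval m ≤ W) (he : e.eval m ≤ W) :
      Exec W (.setNat a i e) m (m.setNat a (i.eval m) (e.eval m)) (i.cost + e.cost + 1)
  | setReal (m : Mem) (a : ℕ) (i : NatExp) (e : RealExp) (hi : i.eval m ≤ W) :
      Exec W (.setReal a i e) m (m.setReal a (i.eval m) (e.eval m)) (i.cost + e.cost + 1)
  | seq {p q : Program} {m m' m'' : Mem} {T T' : ℕ} (hp : Exec W p m m' T)
      (hq : Exec W q m' m'' T') : Exec W (.seq p q) m m'' (T + T')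
  | iteTrue {b : Test} {p q : Program} {m m' : Mem} {T : ℕ} (hb : b.Holds m)
      (hp : Exec W p m m' T) : Exec W (.ite b p q) m m' (b.cost + T)
  | iteFalse {b : Test} {p q : Program} {m m' : Mem} {T : ℕ} (hb : ¬ b.Holds m)
      (hq : Exec W q m m' T) : Exec W (.ite b p q) m m' (b.cost + T)
  | whileTrue {b : Test} {p : Program} {m m' m'' : Mem} {T T' : ℕ} (hb : b.Holds m)
      (hp : Exec W p m m' T) (hw : Exec W (.while b p) m' m'' T') :
      Exec W (.while b p) m m'' (b.cost + T + T')
  | whileFalse {b : Test} {p : Program} {m : Mem} (hb : ¬ b.Holds m) :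
      Exec W (.while b p) m m b.cost

/-! ### Input and output -/

/-- The side (or corner) with number `k`; side `(t, s)` has the number `3 * t + s`. -/
def sideOfIndex {n : ℕ} (k : ℕ) (hk : k < 3 * n) : Fin n × Fin 3 :=
  (⟨k / 3, Nat.div_lt_of_lt_mul hk⟩, ⟨k % 3, Nat.mod_lt k (by norm_num)⟩)

/-- The initial memory.  Natural numbers: array 0 holds the number `n` of triangles in cell 0;
cell `3 * t + s` of array 1 holds the number `3 * t' + s'` of the side `(t', s')` that is glued to
side `(t, s)` (the number of `(t, s)` itself if it is a boundary side), the same cell of array 2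
tells whether the gluing is reversed.  Reals: cell `3 * t + s` of array 0 holds the length of side
`(t, s)`.  All other cells are zero. -/
def inputMem {n : ℕ} (M : TriangulatedSurface n) (S : TriangleShapes n) : Mem where
  nat a k :=
    if a = 0 ∧ k = 0 then n
    else if hk : k < 3 * n then
      if a = 1 then 3 * ((M.mate (sideOfIndex k hk)).1 : ℕ) + ((M.mate (sideOfIndex k hk)).2 : ℕ)
      else if a = 2 ∧ M.reversed (sideOfIndex k hk) = true then 1
      else 0
    else 0
  real a k :=
    if hk : k < 3 * n then
      if a = 0 then S.len (sideOfIndex k hk).1 (sideOfIndex k hk).2 else 0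
    else 0

/-- The layout in the final memory: the coordinates of corner `i` of the triangle `t` are in cell
`3 * t + i` of the real arrays 1 and 2. -/
def outputLayout (n : ℕ) (m : Mem) : Layout n :=
  fun t i => !₂[m.real 1 (3 * (t : ℕ) + (i : ℕ)), m.real 2 (3 * (t : ℕ) + (i : ℕ))]

end VertexUnfolding

end

noncomputable section

set_option linter.unusedSimpArgs false

namespace VertexUnfolding

/-! ### Reasoning about programs -/

namespace Program

/-! A facet path visits every triangle once, passes from each triangle to the next through a vertex
of the surface, and enters and leaves each triangle at different corners. Along such a path the
triangles can be strung out from left to right: each one is turned so that its entry corner is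
leftmost and its exit corner rightmost, so it fills a vertical strip of its own, and consecutive
strips meet at the common vertex (`Placed.insert`, `slopes_spec`, `placeItem_spec`). It remains to
find a facet path.

The path follows a spanning tree of the dual graph, which is connected because the surface is
(`mem_of_connectedSpace`). Consider a subtree entered through the side `ab` of its top triangle, and
let `u` be the third corner. It has a facet path that starts at `a` and ends either at `a` (type 1)
or at `b` (type 2); the type depends only on the subtree, and `a` and `b` may be exchanged. Indeed,
the path of the subtree across `au`, started at `a`, ends at `a` or at `u`; the path across `bu` can
be started at `b` or at `u` so that it ends at `b`. If the two inner endpoints differ, the triangle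
is traversed from the one to the other, and the whole path ends at `b`. They agree only if both
subtrees have type 2: then both endpoints are `u`, the two paths join up to one from `a` through `u`
to `b`, and the triangle is traversed last, from `b` back to `a`. The root counts as entered through
side 0, and a subtree across side 0 is appended where the path of the root ends. Only sides of the
tree are ever crossed, so boundary sides, self-gluings and nonorientability do no harm.

The program unrolls this recursion. Breadth-first search yields the tree (`runs_search`), a backward
pass over the queue yields the types (`runs_typing`), and a stack holds the items of the path still
to be done. `Pending` says what the stack means; `Pending.expand` and `Pending.place` show that a
round of the main loop preserves it. Each triangle is expanded once and placed once, so there are at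
most `2 * n` rounds. Loops are never nested, so the time is a constant times the largest number of
rounds of a loop, as recorded by `Runs`. -/

open Classical in
/-- The effect of a program without loops. -/
def den : Program → Mem → Mem
  | skip, m => m
  | setNat a i e, m => m.setNat a (i.eval m) (e.eval m)
  | setReal a i e, m => m.setReal a (i.eval m) (e.eval m)
  | seq p q, m => q.den (p.den m)
  | ite b p q, m => if b.Holds m then p.den m else q.den m
  | .while _ _, m => m

/-- A program without loops that keeps to the word size `W` when it is started with `m`. -/
def Ok (W : ℕ) : Program → Mem → Prop
  | skip, _ => True
  | setNat _ i e, m => i.eval m ≤ W ∧ e.eval m ≤ W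
  | setReal _ i _, m => i.eval m ≤ W
  | seq p q, m => p.Ok W m ∧ q.Ok W (p.den m)
  | ite b p q, m => (b.Holds m → p.Ok W m) ∧ (¬ b.Holds m → q.Ok W m)
  | .while _ _, _ => False

/-- An upper bound for the running time of a program without loops; loops count as if they were
executed once. -/
def maxCost : Program → ℕ
  | skip => 1
  | setNat _ i e => i.cost + e.cost + 1
  | setReal _ i e => i.cost + e.cost + 1
  | seq p q => p.maxCost + q.maxCost
  | ite b p q => b.cost + (p.maxCost + q.maxCost)
  | .while b p => b.cost + p.maxCost

/-- The arrays of natural numbers that a program may change. -/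
def natWrites : Program → List ℕ
  | skip => []
  | setNat a _ _ => [a]
  | setReal _ _ _ => []
  | seq p q => p.natWrites ++ q.natWrites
  | ite _ p q => p.natWrites ++ q.natWrites
  | .while _ p => p.natWrites

/-- The arrays of real numbers that a program may change. -/
def realWrites : Program → List ℕ
  | skip => []
  | setNat _ _ _ => []
  | setReal a _ _ => [a]
  | seq p q => p.realWrites ++ q.realWrites
  | ite _ p q => p.realWrites ++ q.realWrites
  | .while _ p => p.realWrites

theorem Ok.exec {W : ℕ} : ∀ {p : Program} {m : Mem}, p.Ok W m →
    ∃ T ≤ p.maxCost, Exec W p m (p.den m) T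
  | skip, m, _ => ⟨1, le_rfl, .skip m⟩
  | setNat a i e, m, h => ⟨_, le_rfl, .setNat m a i e h.1 h.2⟩
  | setReal a i e, m, h => ⟨_, le_rfl, .setReal m a i e h⟩
  | seq p q, m, h => by
    obtain ⟨T, hT, hp⟩ := Ok.exec h.1
    obtain ⟨T', hT', hq⟩ := Ok.exec h.2
    exact ⟨T + T', by simp only [maxCost]; omega, .seq hp hq⟩
  | ite b p q, m, h => by
    by_cases hb : b.Holds m
    · obtain ⟨T, hT, hp⟩ := Ok.exec (h.1 hb)
      refine ⟨b.cost + T, by simp only [maxCost]; omega, ?_⟩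
      rw [den, if_pos hb]
      exact .iteTrue hb hp
    · obtain ⟨T, hT, hp⟩ := Ok.exec (h.2 hb)
      refine ⟨b.cost + T, by simp only [maxCost]; omega, ?_⟩
      rw [den, if_neg hb]
      exact .iteFalse hb hp
  | .while _ _, _, h => h.elim

end Program

@[simp] theorem Mem.nat_setNat_self (m : Mem) (a i v j : ℕ) :
    (m.setNat a i v).nat a j = if j = i then v else m.nat a j := by
  simp [Mem.setNat]

@[simp] theorem Mem.nat_setNat_of_ne (m : Mem) {a b : ℕ} (i v : ℕ) (h : b ≠ a) :
    (m.setNat a i v).nat b = m.nat b := by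
  funext j; simp [Mem.setNat, h]

@[simp] theorem Mem.real_setNat (m : Mem) (a i v : ℕ) : (m.setNat a i v).real = m.real := rfl

@[simp] theorem Mem.real_setReal_self (m : Mem) (a i : ℕ) (v : ℝ) (j : ℕ) :
    (m.setReal a i v).real a j = if j = i then v else m.real a j := by
  simp [Mem.setReal]

@[simp] theorem Mem.real_setReal_of_ne (m : Mem) {a b : ℕ} (i : ℕ) (v : ℝ) (h : b ≠ a) :
    (m.setReal a i v).real b = m.real b := by
  funext j; simp [Mem.setReal, h]

@[simp] theorem Mem.nat_setReal (m : Mem) (a i : ℕ) (v : ℝ) : (m.setReal a i v).nat = m.nat := rfl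

theorem Exec.nat_eq {W : ℕ} {p : Program} {m m' : Mem} {T : ℕ} (h : Exec W p m m' T) {a : ℕ}
    (ha : a ∉ p.natWrites) : m'.nat a = m.nat a := by
  induction h with
  | skip => rfl
  | setNat m b i e hi he =>
    exact Mem.nat_setNat_of_ne _ _ _ (by simpa [Program.natWrites] using ha)
  | setReal => rfl
  | seq hp hq ihp ihq =>
    simp only [Program.natWrites, List.mem_append, not_or] at ha
    rw [ihq ha.2, ihp ha.1]
  | iteTrue hb hp ih =>
    simp only [Program.natWrites, List.mem_append, not_or] at ha
    exact ih ha.1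
  | iteFalse hb hp ih =>
    simp only [Program.natWrites, List.mem_append, not_or] at ha
    exact ih ha.2
  | whileTrue hb hp hw ih ih' => rw [ih' ha, ih ha]
  | whileFalse => rfl

theorem Exec.real_eq {W : ℕ} {p : Program} {m m' : Mem} {T : ℕ} (h : Exec W p m m' T) {a : ℕ}
    (ha : a ∉ p.realWrites) : m'.real a = m.real a := by
  induction h with
  | skip => rfl
  | setReal m b i e hi =>
    exact Mem.real_setReal_of_ne _ _ _ (by simpa [Program.realWrites] using ha)
  | setNat => rfl
  | seq hp hq ihp ihq =>
    simp only [Program.realWrites, List.mem_append, not_or] at ha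
    rw [ihq ha.2, ihp ha.1]
  | iteTrue hb hp ih =>
    simp only [Program.realWrites, List.mem_append, not_or] at ha
    exact ih ha.1
  | iteFalse hb hp ih =>
    simp only [Program.realWrites, List.mem_append, not_or] at ha
    exact ih ha.2
  | whileTrue hb hp hw ih ih' => rw [ih' ha, ih ha]
  | whileFalse => rfl

theorem Program.nat_den {a : ℕ} : ∀ {p : Program} (m : Mem), a ∉ p.natWrites →
    (p.den m).nat a = m.nat a
  | skip, _, _ => rfl
  | setNat _ _ _, m, h => Mem.nat_setNat_of_ne _ _ _ (by simpa [natWrites] using h)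
  | setReal _ _ _, _, _ => rfl
  | seq p q, m, h => by
    simp only [natWrites, List.mem_append, not_or] at h
    rw [den, nat_den _ h.2, nat_den _ h.1]
  | ite b p q, m, h => by
    simp only [natWrites, List.mem_append, not_or] at h
    rw [den]
    split_ifs
    · exact nat_den _ h.1
    · exact nat_den _ h.2
  | .while _ _, _, _ => rfl

theorem Program.real_den {a : ℕ} : ∀ {p : Program} (m : Mem), a ∉ p.realWrites →
    (p.den m).real a = m.real a
  | skip, _, _ => rfl
  | setReal _ _ _, m, h => Mem.real_setReal_of_ne _ _ _ (by simpa [realWrites] using h)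
  | setNat _ _ _, _, _ => rfl
  | seq p q, m, h => by
    simp only [realWrites, List.mem_append, not_or] at h
    rw [den, real_den _ h.2, real_den _ h.1]
  | ite b p q, m, h => by
    simp only [realWrites, List.mem_append, not_or] at h
    rw [den]
    split_ifs
    · exact real_den _ h.1
    · exact real_den _ h.2
  | .while _ _, _, _ => rfl

/-- Started with memory `m`, the program `p` halts in a state with `Q`, and its running time is that
of a program whose loops take at most `N` rounds. -/
def Runs (W N : ℕ) (p : Program) (m : Mem) (Q : Mem → Prop) : Prop :=
  ∃ m' T, Exec W p m m' T ∧ T ≤ p.maxCost * (N + 1) ∧ Q m'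

theorem Program.Ok.runs {W N : ℕ} {p : Program} {m : Mem} {Q : Mem → Prop} (h : p.Ok W m)
    (hQ : Q (p.den m)) : Runs W N p m Q :=
  let ⟨T, hT, hp⟩ := h.exec
  ⟨_, T, hp, hT.trans (Nat.le_mul_of_pos_right _ N.succ_pos), hQ⟩

/-- `maxCost` is additive and the bound `N` on the rounds is shared, so time bounds of successive
loops combine without constants to track. -/
theorem Runs.seq {W N : ℕ} {p q : Program} {m : Mem} {Q R : Mem → Prop}
    (hp : Runs W N p m Q) (hq : ∀ m', Q m' → Runs W N q m' R) :
    Runs W N (.seq p q) m R := by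
  obtain ⟨m', S, h, hS, hm'⟩ := hp
  obtain ⟨m'', S', h', hS', hm''⟩ := hq m' hm'
  refine ⟨m'', S + S', .seq h h', ?_, hm''⟩
  rw [Program.maxCost, Nat.add_mul]
  omega

theorem Runs.mono {W N : ℕ} {p : Program} {m : Mem} {Q R : Mem → Prop}
    (hp : Runs W N p m Q) (h : ∀ m', Q m' → R m') : Runs W N p m R :=
  let ⟨m', S, hS, hST, hm'⟩ := hp
  ⟨m', S, hS, hST, h m' hm'⟩

/-- The frame rule. -/
theorem Runs.frame {W N : ℕ} {p : Program} {m : Mem} {Q : Mem → Prop}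
    (hp : Runs W N p m Q) : Runs W N p m (fun m' => Q m' ∧
      (∀ a, a ∉ p.natWrites → m'.nat a = m.nat a) ∧
      ∀ a, a ∉ p.realWrites → m'.real a = m.real a) :=
  let ⟨m', S, hS, hST, hm'⟩ := hp
  ⟨m', S, hS, hST, hm', fun _ => hS.nat_eq, fun _ => hS.real_eq⟩

/-- Termination of a loop whose body has no loops, by induction on the bound for the number of
rounds. -/
theorem exec_while {W : ℕ} {b : Test} {p : Program} (I : Mem → Prop) (φ : Mem → ℕ)
    (hI : ∀ m, I m → b.Holds m → p.Ok W m ∧ I (p.den m) ∧ φ (p.den m) < φ m) (k : ℕ) :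
    ∀ m, φ m = k → I m → ∃ m' T, Exec W (.while b p) m m' T ∧
      T ≤ φ m * (b.cost + p.maxCost) + b.cost ∧ I m' ∧ ¬ b.Holds m' := by
  induction k using Nat.strong_induction_on with
  | _ k ih =>
    intro m hk hm
    by_cases hb : b.Holds m
    · obtain ⟨h1, h2, h3⟩ := hI m hm hb
      obtain ⟨T, hT, hp⟩ := h1.exec
      obtain ⟨m', T', hw, hT', hm'⟩ := ih _ (hk ▸ h3) _ rfl h2
      refine ⟨m', _, .whileTrue hb hp hw, ?_, hm'⟩
      have : (φ (p.den m) + 1) * (b.cost + p.maxCost) ≤ φ m * (b.cost + p.maxCost) :=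
        Nat.mul_le_mul_right _ h3
      rw [Nat.add_mul] at this
      omega
    · exact ⟨m, _, .whileFalse hb, by omega, hm, hb⟩

/-- Loops whose body has no loops: `I` is an invariant, and `φ` bounds the number of rounds. The
frame rule is built in. -/
theorem runs_while {W N : ℕ} {b : Test} {p : Program} {m₀ : Mem} (I : Mem → Prop) (φ : Mem → ℕ)
    (h₀ : I m₀) (hφ : φ m₀ ≤ N)
    (hI : ∀ m, I m → (∀ a, a ∉ p.natWrites → m.nat a = m₀.nat a) →
      (∀ a, a ∉ p.realWrites → m.real a = m₀.real a) → b.Holds m →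
      p.Ok W m ∧ I (p.den m) ∧ φ (p.den m) < φ m) :
    Runs W N (.while b p) m₀ (fun m' => I m' ∧ ¬ b.Holds m' ∧
      (∀ a, a ∉ p.natWrites → m'.nat a = m₀.nat a) ∧
      ∀ a, a ∉ p.realWrites → m'.real a = m₀.real a) := by
  obtain ⟨m', T, h1, h2, h3⟩ := exec_while (fun m => I m ∧
      (∀ a, a ∉ p.natWrites → m.nat a = m₀.nat a) ∧
      ∀ a, a ∉ p.realWrites → m.real a = m₀.real a) φ
    (fun m hm hb =>
      let h := hI m hm.1 hm.2.1 hm.2.2 hb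
      ⟨h.1, ⟨h.2.1, fun a ha => (Program.nat_den m ha).trans (hm.2.1 a ha),
        fun a ha => (Program.real_den m ha).trans (hm.2.2 a ha)⟩, h.2.2⟩)
    _ m₀ rfl ⟨h₀, fun _ _ => rfl, fun _ _ => rfl⟩
  refine ⟨m', T, h1, h2.trans ?_, h3.1.1, h3.2, h3.1.2⟩
  -- At most `N` rounds, plus the final failing test, which the `+ 1` in `N + 1` pays for.
  have := Nat.mul_le_mul_right (b.cost + p.maxCost) hφ
  rw [Program.maxCost, Nat.mul_succ, Nat.mul_comm _ N]
  omega

/-- The variable `a`: cell 0 of the array `a`. -/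
abbrev NatExp.var (a : ℕ) : NatExp := .load a (.const 0)

/-- The variable `a`: cell 0 of the array `a`. -/
abbrev RealExp.var (a : ℕ) : RealExp := .load a (.const 0)

/-- Assignment to a variable. -/
abbrev Program.assign (a : ℕ) (e : NatExp) : Program := .setNat a (.const 0) e

/-- Assignment to a variable. -/
abbrev Program.assignReal (a : ℕ) (e : RealExp) : Program := .setReal a (.const 0) e

/-! ### Corners as numbers

Corner `i` of the triangle `t`, and the side that starts there, have the number `3 * t + i`. -/

/-- The next corner of the same triangle. -/
def nx (k : ℕ) : ℕ := if k % 3 = 2 then k - 2 else k + 1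

theorem nx_div (k : ℕ) : nx k / 3 = k / 3 := by unfold nx; split_ifs <;> omega

theorem nx_nx_nx (k : ℕ) : nx (nx (nx k)) = k := by unfold nx; split_ifs <;> omega

theorem nx_ne (k : ℕ) : nx k ≠ k := by unfold nx; split_ifs <;> omega

theorem nx_nx_ne (k : ℕ) : nx (nx k) ≠ k := by unfold nx; split_ifs <;> omega

theorem nx_lt {n k : ℕ} (h : k < 3 * n) : nx k < 3 * n := by unfold nx; split_ifs <;> omega

theorem div_eq_iff_nx {k l : ℕ} : k / 3 = l / 3 ↔ k = l ∨ k = nx l ∨ k = nx (nx l) := by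
  unfold nx; split_ifs <;> omega

/-- Different corners of the same triangle. -/
def Adj (a b : ℕ) : Prop := nx a = b ∨ nx b = a

theorem Adj.symm {a b : ℕ} (h : Adj a b) : Adj b a := Or.symm h

theorem Adj.div_eq {a b : ℕ} (h : Adj a b) : a / 3 = b / 3 := by
  rcases h with rfl | rfl <;> simp [nx_div]

/-- The side between two corners of the same triangle. -/
def side (a b : ℕ) : ℕ := if nx a = b then a else b

theorem side_comm {a b : ℕ} (h : Adj a b) : side a b = side b a := by
  unfold side
  rcases h with rfl | rfl
  · simp [nx_nx_ne]
  · simp [nx_nx_ne]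

theorem side_div {a b : ℕ} (h : Adj a b) : side a b / 3 = a / 3 := by
  unfold side
  split_ifs
  · rfl
  · exact h.div_eq.symm

/-- The third corner of the triangle. -/
def third (a b : ℕ) : ℕ := if nx a = b then nx b else nx a

theorem adj_third_left {a b : ℕ} (h : Adj a b) : Adj a (third a b) := by
  unfold third Adj
  rcases h with rfl | rfl
  · simp [nx_nx_nx]
  · simp [nx_nx_ne]

theorem adj_third_right {a b : ℕ} (h : Adj a b) : Adj b (third a b) := by
  unfold third Adj
  rcases h with rfl | rfl
  · simp
  · simp [nx_nx_ne, nx_nx_nx]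

/-- The alternative is the cyclic order of `a` and `b`. Statements symmetric in the two other sides,
such as `Closed`, do not depend on it. -/
theorem sides_third {a b : ℕ} (h : Adj a b) :
    side a (third a b) = nx (side a b) ∧ side b (third a b) = nx (nx (side a b)) ∨
      side a (third a b) = nx (nx (side a b)) ∧ side b (third a b) = nx (side a b) := by
  unfold side third
  rcases h with rfl | rfl
  · right
    simp [(nx_ne _).symm]
  · left
    have h1 : nx b ≠ nx (nx b) := (nx_ne _).symm
    simp [nx_nx_ne, h1]

/-! ### Gluings in terms of corner numbers -/

/-- A surface in terms of the numbers of its corners: `opp s` is the side glued to the side `s`,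
`m₀ s` and `m₁ s` are the corners glued to the start and to the end of `s`, and `V k` is the vertex
of the corner `k`. -/
structure IsGluing {X : Type*} (n : ℕ) (opp m₀ m₁ : ℕ → ℕ) (V : ℕ → X) : Prop where
  opp_lt : ∀ s < 3 * n, opp s < 3 * n
  opp_opp : ∀ s < 3 * n, opp (opp s) = s
  vertex₀ : ∀ s < 3 * n, V (m₀ s) = V s
  vertex₁ : ∀ s < 3 * n, V (m₁ s) = V (nx s)
  ends : ∀ s < 3 * n, m₀ s = opp s ∧ m₁ s = nx (opp s) ∨ m₀ s = nx (opp s) ∧ m₁ s = opp s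

/-- The corner across the side from `x` to `y` that is glued to `x`. -/
def across (m₀ m₁ : ℕ → ℕ) (x y : ℕ) : ℕ := if nx x = y then m₀ x else m₁ y

namespace IsGluing

variable {X : Type*} {n : ℕ} {opp m₀ m₁ : ℕ → ℕ} {V : ℕ → X}

theorem vertex_across (h : IsGluing n opp m₀ m₁ V) {x y : ℕ} (hxy : Adj x y) (hx : x < 3 * n)
    (hy : y < 3 * n) : V (across m₀ m₁ x y) = V x := by
  unfold across
  rcases hxy with rfl | rfl
  · simp [h.vertex₀ x hx]
  · simp [nx_nx_ne, h.vertex₁ y hy]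

/-- Reversed or not, the gluing matches ends with ends. Hence the corners across `x` and `y`, in
this order, describe an entrance to the neighbouring triangle that starts at the vertex of `x`. -/
theorem across_spec (h : IsGluing n opp m₀ m₁ V) {x y : ℕ} (hxy : Adj x y) (hx : x < 3 * n)
    (hy : y < 3 * n) : Adj (across m₀ m₁ x y) (across m₀ m₁ y x) ∧
      side (across m₀ m₁ x y) (across m₀ m₁ y x) = opp (side x y) ∧
      across m₀ m₁ x y < 3 * n ∧ across m₀ m₁ x y / 3 = opp (side x y) / 3 := by
  unfold across Adj
  rcases hxy with rfl | rfl
  · have := nx_lt (h.opp_lt x hx)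
    rcases h.ends x hx with ⟨h1, h2⟩ | ⟨h1, h2⟩ <;>
      simp [nx_nx_ne, side, h1, h2, h.opp_lt x hx, this, nx_div]
  · have := nx_lt (h.opp_lt y hy)
    rcases h.ends y hy with ⟨h1, h2⟩ | ⟨h1, h2⟩ <;>
      simp [nx_nx_ne, side, h1, h2, h.opp_lt y hy, this, nx_div]

end IsGluing

/-! ### Spanning trees of the dual graph -/

/-- `q 0, …, q (L - 1)` are sides of different triangles, such that each of them except `q 0 = 0` is
glued to side `0` or to one of the two other sides of the triangle of an earlier one. -/
structure IsDualTree (n : ℕ) (opp q : ℕ → ℕ) (L : ℕ) : Prop where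
  pos : 0 < L
  root : q 0 = 0
  lt : ∀ i < L, q i < 3 * n
  inj : ∀ i < L, ∀ j < L, q i / 3 = q j / 3 → i = j
  parent : ∀ i < L, 0 < i →
    opp (q i) = 0 ∨ ∃ j < i, opp (q i) = nx (q j) ∨ opp (q i) = nx (nx (q j))

theorem IsDualTree.le {n : ℕ} {opp q : ℕ → ℕ} {L : ℕ} (h : IsDualTree n opp q L) : L ≤ n := by
  have := Finset.card_le_card_of_injOn (s := Finset.range L) (t := Finset.range n)
    (fun i => q i / 3)
    (fun i hi => by
      have := h.lt i (by simpa using hi)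
      simp only [Finset.coe_range, Set.mem_Iio]
      omega)
    (fun i hi j hj => h.inj i (by simpa using hi) j (by simpa using hj))
  simpa using this

/-! ### Types of subtrees and items of facet paths -/

/-- The two other sides of the triangle lead to subtrees with a path between the ends of the
side. -/
def Closed (τ : ℕ → ℕ) (e : ℕ) : Prop := τ (nx e) = 2 ∧ τ (nx (nx e)) = 2

theorem closed_iff_third {τ : ℕ → ℕ} {a b : ℕ} (h : Adj a b) :
    Closed τ (side a b) ↔ τ (side a (third a b)) = 2 ∧ τ (side b (third a b)) = 2 := by
  unfold Closed
  rcases sides_third h with ⟨h1, h2⟩ | ⟨h1, h2⟩ <;> rw [h1, h2]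
  exact and_comm

open Classical in
/-- `τ s` tells whether there is a subtree across the side `s`; it is 1 if the facet paths of the
subtree are closed, and 2 if they connect the ends of the side. -/
structure IsTyping (n : ℕ) (opp q τ : ℕ → ℕ) : Prop where
  child : ∀ i < n, 0 < i → τ (opp (q i)) = if Closed τ (q i) then 1 else 2
  zero : ∀ s, (∀ i < n, 0 < i → s ≠ opp (q i)) → τ s = 0

/-- An item of a facet path: the triangle with the corners `a` and `b`, traversed from `a` to `b`,
if `tag = 1`, or the subtree entered through the side between `a` and `b`, starting at `a`, if
`tag = 0`. -/
@[ext] structure Item where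
  tag : ℕ
  a : ℕ
  b : ℕ

open Classical in
/-- The corner where an item ends. -/
def Item.last (τ : ℕ → ℕ) (x : Item) : ℕ :=
  if x.tag = 0 ∧ Closed τ (side x.a x.b) then x.a else x.b

/-- Each item starts at the vertex where the preceding one ended. -/
def IsChain {X : Type*} (V : ℕ → X) (τ : ℕ → ℕ) : X → List Item → Prop
  | _, [] => True
  | c, x :: l => V x.a = c ∧ IsChain V τ (V (x.last τ)) l

/-- The items that replace a subtree `x`. -/
def expansion (m₀ m₁ τ : ℕ → ℕ) (x : Item) : List Item :=
  let a := x.a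
  let b := x.b
  let u := third a b
  let s := side a u
  let t := side b u
  (if 1 ≤ τ s then [⟨0, across m₀ m₁ a u, across m₀ m₁ u a⟩] else []) ++
  (if 2 ≤ τ s ∧ 2 ≤ τ t then [⟨0, across m₀ m₁ u b, across m₀ m₁ b u⟩, ⟨1, b, a⟩] else
    ⟨1, if 2 ≤ τ s then u else a, if 2 ≤ τ t then u else b⟩ ::
    (if 2 ≤ τ t then [⟨0, across m₀ m₁ u b, across m₀ m₁ b u⟩] else
      if 1 ≤ τ t then [⟨0, across m₀ m₁ b u, across m₀ m₁ u b⟩] else []))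

/-- The combinatorial invariant: the triangles in `E` have been placed, the current vertex is `c`,
and the items in `l` remain to be done. -/
structure Pending {X : Type*} (n : ℕ) (opp q τ : ℕ → ℕ) (V : ℕ → X) (E : Set ℕ) (l : List Item)
    (c : X) : Prop where
  lt : ∀ x ∈ l, x.a < 3 * n ∧ x.b < 3 * n
  adj : ∀ x ∈ l, Adj x.a x.b
  tag : ∀ x ∈ l, x.tag = 0 ∧ (∃ i < n, side x.a x.b = q i) ∨ x.tag = 1
  pairwise : l.Pairwise fun x y => x.a / 3 ≠ y.a / 3
  notMem : ∀ x ∈ l, x.a / 3 ∉ E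
  sub : ∀ t ∈ E, t < n
  root : 0 ∈ E ∨ ∃ x ∈ l, x.a / 3 = 0
  tree : ∀ j < n, 0 < j → ((q j / 3 ∈ E ∨ ∃ x ∈ l, x.a / 3 = q j / 3) ↔
    (opp (q j) = 0 ∨ opp (q j) / 3 ∈ E ∨ ∃ x ∈ l, x.tag = 1 ∧ x.a / 3 = opp (q j) / 3))
  chain : IsChain V τ c l

/-! ### The combinatorial invariant under expanding and placing -/

section

variable {X : Type*} {n : ℕ} {opp m₀ m₁ q τ : ℕ → ℕ} {V : ℕ → X}

theorem IsTyping.le_two (h : IsTyping n opp q τ) (s : ℕ) : τ s ≤ 2 := by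
  by_cases hs : ∃ i < n, 0 < i ∧ s = opp (q i)
  · obtain ⟨i, hi, h0, rfl⟩ := hs
    rw [h.child i hi h0]
    split_ifs <;> omega
  · push Not at hs
    rw [h.zero s hs]
    omega

/-- A nonzero type certifies a side of the tree, seen from the parent, since all other sides have
type 0. -/
theorem IsTyping.spec (hg : IsGluing n opp m₀ m₁ V) (hq : IsDualTree n opp q n)
    (h : IsTyping n opp q τ) {s : ℕ} (hs : 1 ≤ τ s) :
    (∃ j < n, 0 < j ∧ opp s = q j ∧ s = opp (q j)) ∧ (τ s = 1 ↔ Closed τ (opp s)) := by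
  by_cases hs' : ∃ i < n, 0 < i ∧ s = opp (q i)
  · obtain ⟨i, hi, h0, rfl⟩ := hs'
    have h1 := hg.opp_opp _ (hq.lt i hi)
    refine ⟨⟨i, hi, h0, h1, rfl⟩, ?_⟩
    rw [h1, h.child i hi h0]
    split_ifs with hc <;> simp [hc]
  · push Not at hs'
    rw [h.zero s hs'] at hs
    omega

/-- The triangle only moves from the items of tag 1 to `E`, and both sides of `tree` treat these
alike. The path goes on from `x.b`, because an item of tag 1 always ends there. -/
theorem Pending.place {E : Set ℕ} {l : List Item} {c : X} {x : Item}
    (h : Pending n opp q τ V E (x :: l) c) (hx : x.tag = 1) :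
    Pending n opp q τ V (insert (x.a / 3) E) l (V x.b) where
  lt y hy := h.lt y (List.mem_cons_of_mem _ hy)
  adj y hy := h.adj y (List.mem_cons_of_mem _ hy)
  tag y hy := h.tag y (List.mem_cons_of_mem _ hy)
  pairwise := (List.pairwise_cons.1 h.pairwise).2
  notMem y hy := by
    have h1 := (List.pairwise_cons.1 h.pairwise).1 y hy
    have h2 := h.notMem y (List.mem_cons_of_mem _ hy)
    simp only [Set.mem_insert_iff, not_or]
    exact ⟨h1.symm, h2⟩
  sub t ht := by
    rcases ht with rfl | ht
    · have := h.lt x (List.mem_cons_self)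
      omega
    · exact h.sub t ht
  root := by
    have := h.root
    simp only [List.mem_cons, exists_eq_or_imp, Set.mem_insert_iff] at this ⊢
    tauto
  tree j hj h0 := by
    have := h.tree j hj h0
    simp only [List.mem_cons, exists_eq_or_imp, Set.mem_insert_iff, hx, true_and] at this ⊢
    rw [eq_comm (a := q j / 3), eq_comm (a := opp (q j) / 3), or_comm (a := x.a / 3 = q j / 3),
      or_comm (a := x.a / 3 = opp (q j) / 3), or_assoc, or_assoc, this]
  chain := by
    have := h.chain.2
    rwa [Item.last, if_neg (by simp [hx])] at this

/-- Which triangles are children of the triangle of `q i`. -/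
theorem IsTyping.parent_iff (hg : IsGluing n opp m₀ m₁ V) (hq : IsDualTree n opp q n)
    (hτ : IsTyping n opp q τ) {i j : ℕ} (hi : i < n) (hj : j < n) (hj0 : 0 < j) :
    opp (q j) / 3 = q i / 3 ↔ opp (q j) = 0 ∧ q i / 3 = 0 ∨
      ∃ s, (s = nx (q i) ∨ s = nx (nx (q i))) ∧ 1 ≤ τ s ∧ opp s = q j := by
  constructor
  · intro h1
    have hτj : 1 ≤ τ (opp (q j)) := by
      rw [hτ.child j hj hj0]; split_ifs <;> omega
    have h1' := h1
    rw [div_eq_iff_nx] at h1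
    rcases h1 with h1 | h1
    · rcases hq.parent j hj hj0 with h2 | ⟨k, hk, h2⟩
      · left
        exact ⟨h2, by rw [← h1', h2]⟩
      · exfalso
        have : k = i := by
          refine hq.inj k (by omega) i hi ?_
          rw [← h1]
          rcases h2 with h2 | h2 <;> simp [h2, nx_div]
        subst this
        rw [h1] at h2
        rcases h2 with h2 | h2
        · exact nx_ne _ h2.symm
        · exact nx_nx_ne _ h2.symm
    · exact Or.inr ⟨opp (q j), h1, hτj, hg.opp_opp _ (hq.lt j hj)⟩
  · rintro (⟨h1, h2⟩ | ⟨s, h1, h2, h3⟩)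
    · rw [h1, h2]
    · obtain ⟨⟨k, hk, hk0, hk1, hk2⟩, -⟩ := hτ.spec hg hq h2
      rw [h3] at hk1
      rw [hk1, ← hk2]
      rcases h1 with rfl | rfl <;> simp [nx_div]

/-- By `tree`, a child appears only after its parent has been placed or has become an item of tag 1.
The subtree `x` is not yet expanded, so its children are new. -/
theorem Pending.child (hg : IsGluing n opp m₀ m₁ V) (hq : IsDualTree n opp q n)
    (hτ : IsTyping n opp q τ) {E : Set ℕ} {l : List Item} {c : X} {x : Item} {i : ℕ} (hi : i < n)
    (h : Pending n opp q τ V E (x :: l) c) (hx : x.tag = 0) (hxi : x.a / 3 = q i / 3) {s : ℕ}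
    (hs : s = nx (q i) ∨ s = nx (nx (q i))) (h1 : 1 ≤ τ s) :
    opp s / 3 ∉ E ∧ (∀ y ∈ l, y.a / 3 ≠ opp s / 3) ∧ opp s / 3 ≠ x.a / 3 := by
  obtain ⟨⟨j, hj, hj0, hj1, hj2⟩, hc⟩ := hτ.spec hg hq h1
  have hs3 : s / 3 = x.a / 3 := by rcases hs with rfl | rfl <;> simp [nx_div, hxi]
  have key := h.tree j hj hj0
  -- The subtree across side 0 is exempt from that rule, so side 0 must be excluded; it is the entry
  -- side of the root.
  have hs0 : s ≠ 0 := by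
    rintro rfl
    have : i = 0 := hq.inj i hi 0 hq.pos (by rw [← hxi, ← hs3, hq.root])
    subst this
    rw [hq.root] at hs
    revert hs
    simp [nx]
  rw [← hj2, hs3] at key
  have hf : ¬ (s = 0 ∨ x.a / 3 ∈ E ∨ ∃ y ∈ x :: l, y.tag = 1 ∧ y.a / 3 = x.a / 3) := by
    simp only [List.mem_cons, exists_eq_or_imp]
    rintro (h2 | h2 | h2 | ⟨y, hy, -, h2⟩)
    · exact hs0 h2
    · exact h.notMem _ List.mem_cons_self h2
    · omega
    · exact (List.pairwise_cons.1 h.pairwise).1 y hy h2.symm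
  rw [← key] at hf
  simp only [List.mem_cons, exists_eq_or_imp, not_or, not_exists, not_and] at hf
  rw [hj1]
  exact ⟨hf.1, hf.2.2, Ne.symm hf.2.1⟩

/-- Isolates what a list must satisfy to stand in for a subtree: its only triangle of tag 1 is the
top triangle, its other triangles are exactly the children, and the chain stays connected.
`Pending.child` gives freshness, and `IsTyping.parent_iff` matches the changes on the two sides of
`tree`. -/
theorem Pending.replace (hg : IsGluing n opp m₀ m₁ V) (hq : IsDualTree n opp q n)
    (hτ : IsTyping n opp q τ) {E : Set ℕ} {l k : List Item} {c : X} {x : Item}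
    (h : Pending n opp q τ V E (x :: l) c) (hx : x.tag = 0)
    (hk : ∀ y ∈ k, (y.a < 3 * n ∧ y.b < 3 * n) ∧ Adj y.a y.b ∧
      (y.tag = 0 ∧ (∃ i < n, side y.a y.b = q i) ∨ y.tag = 1))
    (hpw : k.Pairwise fun x y => x.a / 3 ≠ y.a / 3)
    (htag : ∀ t, (∃ y ∈ k, y.tag = 1 ∧ y.a / 3 = t) ↔ t = x.a / 3)
    (hmem : ∀ t, (∃ y ∈ k, y.a / 3 = t) ↔ t = x.a / 3 ∨
      ∃ s, (s = nx (side x.a x.b) ∨ s = nx (nx (side x.a x.b))) ∧ 1 ≤ τ s ∧ t = opp s / 3)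
    (hch : IsChain V τ c (k ++ l)) :
    Pending n opp q τ V E (k ++ l) c := by
  have hadj := h.adj _ List.mem_cons_self
  obtain ⟨i, hi, hi'⟩ : ∃ i < n, side x.a x.b = q i := by
    simpa [hx] using h.tag _ List.mem_cons_self
  have hxi : x.a / 3 = q i / 3 := by rw [← hi', side_div hadj]
  rw [hi'] at hmem
  have hch' := fun s hs h1 => h.child hg hq hτ hi hx hxi (s := s) hs h1
  have hl := List.pairwise_cons.1 h.pairwise
  have hkE : ∀ y ∈ k, y.a / 3 ∉ E ∧ ∀ z ∈ l, y.a / 3 ≠ z.a / 3 := by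
    intro y hy
    rcases (hmem _).1 ⟨y, hy, rfl⟩ with h1 | ⟨s, hs, h1, h2⟩
    · rw [h1]
      exact ⟨h.notMem _ List.mem_cons_self, hl.1⟩
    · rw [h2]
      exact ⟨(hch' s hs h1).1, fun z hz => ((hch' s hs h1).2.1 z hz).symm⟩
  refine ⟨?_, ?_, ?_, ?_, ?_, h.sub, ?_, ?_, hch⟩
  · intro y hy
    rcases List.mem_append.1 hy with hy | hy
    · exact (hk y hy).1
    · exact h.lt y (List.mem_cons_of_mem _ hy)
  · intro y hy
    rcases List.mem_append.1 hy with hy | hy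
    · exact (hk y hy).2.1
    · exact h.adj y (List.mem_cons_of_mem _ hy)
  · intro y hy
    rcases List.mem_append.1 hy with hy | hy
    · exact (hk y hy).2.2
    · exact h.tag y (List.mem_cons_of_mem _ hy)
  · exact List.pairwise_append.2 ⟨hpw, hl.2, fun y hy => (hkE y hy).2⟩
  · intro y hy
    rcases List.mem_append.1 hy with hy | hy
    · exact (hkE y hy).1
    · exact h.notMem y (List.mem_cons_of_mem _ hy)
  · rcases h.root with h1 | ⟨y, hy, h1⟩
    · exact Or.inl h1
    · right
      rcases List.mem_cons.1 hy with rfl | hy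
      · obtain ⟨z, hz, h2⟩ := (hmem _).2 (Or.inl rfl)
        exact ⟨z, List.mem_append_left _ hz, h2.trans h1⟩
      · exact ⟨y, List.mem_append_right _ hy, h1⟩
  · intro j hj hj0
    have key := h.tree j hj hj0
    have hpar := hτ.parent_iff hg hq hi hj hj0
    simp only [List.mem_cons, exists_eq_or_imp, hx, zero_ne_one, false_and, false_or] at key
    have happ : ∀ p : Item → Prop, (∃ y ∈ k ++ l, p y) ↔ (∃ y ∈ k, p y) ∨ ∃ y ∈ l, p y := by
      intro p
      simp only [List.mem_append, or_and_right, exists_or]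
    rw [happ, happ, hmem, htag]
    have hs : (∃ s, (s = nx (q i) ∨ s = nx (nx (q i))) ∧ 1 ≤ τ s ∧ q j / 3 = opp s / 3) ↔
        ∃ s, (s = nx (q i) ∨ s = nx (nx (q i))) ∧ 1 ≤ τ s ∧ opp s = q j := by
      refine exists_congr fun s => and_congr_right fun _ => and_congr_right fun h1 => ?_
      obtain ⟨⟨k, hk, hk0, hk1, hk2⟩, -⟩ := hτ.spec hg hq h1
      rw [hk1]
      constructor
      · intro h2
        rw [hq.inj j hj k hk h2]
      · intro h2
        rw [h2]
    rw [hs, hxi, hpar, eq_comm (a := q j / 3)]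
    rw [hxi] at key
    -- Both sides of the equivalence gain the same children `S`; the extra case `D ∧ Z` is absorbed
    -- by `D`.
    have prop : ∀ {A B C D F G Z S : Prop}, (A ∨ B ∨ C ↔ D ∨ F ∨ G) →
        (A ∨ (B ∨ S) ∨ C ↔ D ∨ F ∨ (D ∧ Z ∨ S) ∨ G) := by
      clear * -
      intros
      grind
    exact prop key

/-- The recursive step of the construction. Once all corners are named, each requirement of
`Pending.replace` is checked for the nine pairs of types of the two child sides. -/
theorem Pending.expand (hg : IsGluing n opp m₀ m₁ V) (hq : IsDualTree n opp q n)
    (hτ : IsTyping n opp q τ) {E : Set ℕ} {l : List Item} {c : X} {x : Item}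
    (h : Pending n opp q τ V E (x :: l) c) (hx : x.tag = 0) :
    Pending n opp q τ V E (expansion m₀ m₁ τ x ++ l) c := by
  obtain ⟨tg, a, b⟩ := x
  simp only at hx
  subst hx
  obtain ⟨ha, hb⟩ : a < 3 * n ∧ b < 3 * n := h.lt _ List.mem_cons_self
  have hab : Adj a b := h.adj _ List.mem_cons_self
  obtain ⟨hch1, hch2⟩ := h.chain
  simp only at hch1
  subst hch1
  -- Types are at most 2, so the test `2 ≤ τ` of the program agrees with `τ = 2` in `Closed`.
  have hlast : (Item.mk 0 a b).last τ = if 2 ≤ τ (side a (third a b)) ∧ 2 ≤ τ (side b (third a b))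
      then a else b := by
    have h1 := hτ.le_two (side a (third a b))
    have h2 := hτ.le_two (side b (third a b))
    simp only [Item.last, closed_iff_third hab, true_and]
    congr 1
    simp only [eq_iff_iff]
    omega
  have hau := adj_third_left hab
  have hbu := adj_third_right hab
  have hsides : ∀ P : ℕ → Prop, (∃ s, (s = nx (side a b) ∨ s = nx (nx (side a b))) ∧ P s) ↔
      P (side a (third a b)) ∨ P (side b (third a b)) := by
    intro P
    rcases sides_third hab with ⟨h1, h2⟩ | ⟨h1, h2⟩ <;>
      simp only [h1, h2, or_and_right, exists_or, exists_eq_left]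
    exact or_comm
  have hsab : side a (third a b) ≠ side b (third a b) := by
    rcases sides_third hab with ⟨h1, h2⟩ | ⟨h1, h2⟩ <;> rw [h1, h2]
    · exact (nx_ne _).symm
    · exact nx_ne _
  have hch : ∀ s, (s = nx (side a b) ∨ s = nx (nx (side a b))) → 1 ≤ τ s →
      opp s / 3 ≠ a / 3 := by
    obtain ⟨i, hi, hi'⟩ : ∃ i < n, side a b = q i := by
      simpa using h.tag _ List.mem_cons_self
    have hxi : a / 3 = q i / 3 := by rw [← hi', side_div hab]
    rw [hi']
    exact fun s hs h1 => (h.child hg hq hτ hi rfl hxi hs h1).2.2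
  have hA : 1 ≤ τ (side a (third a b)) → opp (side a (third a b)) / 3 ≠ a / 3 :=
    hch _ (by rcases sides_third hab with ⟨h1, h2⟩ | ⟨h1, h2⟩ <;> simp [h1])
  have hB : 1 ≤ τ (side b (third a b)) → opp (side b (third a b)) / 3 ≠ a / 3 :=
    hch _ (by rcases sides_third hab with ⟨h1, h2⟩ | ⟨h1, h2⟩ <;> simp [h2])
  -- Children in the same triangle would have the same entry side in the tree, hence lie across the
  -- same side.
  have hAB : 1 ≤ τ (side a (third a b)) → 1 ≤ τ (side b (third a b)) →
      opp (side a (third a b)) / 3 ≠ opp (side b (third a b)) / 3 := by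
    intro h1 h2 h3
    obtain ⟨⟨j, hj, hj0, hj1, hj2⟩, -⟩ := hτ.spec hg hq h1
    obtain ⟨⟨k, hk, hk0, hk1, hk2⟩, -⟩ := hτ.spec hg hq h2
    rw [hj1, hk1] at h3
    have := hq.inj j hj k hk h3
    subst this
    exact hsab (hj2.trans hk2.symm)
  have hun : third a b < 3 * n := by
    have := hau.div_eq
    omega
  obtain ⟨au1, au2, au3, au4⟩ := hg.across_spec hau ha hun
  obtain ⟨ua1, ua2, ua3, ua4⟩ := hg.across_spec hau.symm hun ha
  obtain ⟨bu1, bu2, bu3, bu4⟩ := hg.across_spec hbu hb hun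
  obtain ⟨ub1, ub2, ub3, ub4⟩ := hg.across_spec hbu.symm hun hb
  have vau := hg.vertex_across hau ha hun
  have vua := hg.vertex_across hau.symm hun ha
  have vbu := hg.vertex_across hbu hb hun
  have vub := hg.vertex_across hbu.symm hun hb
  rw [side_comm hau.symm] at ua2 ua4
  rw [side_comm hbu.symm] at ub2 ub4
  have hat := hab.div_eq.symm
  have hut := hau.div_eq.symm
  have ta := hτ.le_two (side a (third a b))
  have tb := hτ.le_two (side b (third a b))
  have hSA := fun h => hτ.spec hg hq (s := side a (third a b)) h
  have hSB := fun h => hτ.spec hg hq (s := side b (third a b)) h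
  have hQA : 1 ≤ τ (side a (third a b)) → ∃ i < n, opp (side a (third a b)) = q i := fun h =>
    let ⟨⟨i, hi, _, h', _⟩, _⟩ := hSA h; ⟨i, hi, h'⟩
  have hQB : 1 ≤ τ (side b (third a b)) → ∃ i < n, opp (side b (third a b)) = q i := fun h =>
    let ⟨⟨i, hi, _, h', _⟩, _⟩ := hSB h; ⟨i, hi, h'⟩
  have hCA := fun h => (hSA h).2
  have hCB := fun h => (hSB h).2
  clear hSA hSB
  rw [hlast] at hch2
  have hadj1 := hab.symm
  have hadj2 := hau.symm
  have hadj3 := hbu.symm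
  refine h.replace hg hq hτ rfl ?_ ?_ ?_ ?_ ?_ <;>
  simp only [expansion, hsides] <;>
  generalize third a b = u at * <;>
  generalize across m₀ m₁ a u = au at * <;>
  generalize across m₀ m₁ u a = ua at * <;>
  generalize across m₀ m₁ b u = bu at * <;>
  generalize across m₀ m₁ u b = ub at * <;>
  generalize side a u = s at * <;>
  generalize side b u = t at * <;>
  clear h hsides hlast hch
  · obtain hs | hs | hs : τ s = 0 ∨ τ s = 1 ∨ τ s = 2 := by omega
    all_goals obtain ht | ht | ht : τ t = 0 ∨ τ t = 1 ∨ τ t = 2 := by omega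
    all_goals simp [hs, ht] at hQA hQB ⊢
    all_goals simp [*]
  · obtain hs | hs | hs : τ s = 0 ∨ τ s = 1 ∨ τ s = 2 := by omega
    all_goals obtain ht | ht | ht : τ t = 0 ∨ τ t = 1 ∨ τ t = 2 := by omega
    all_goals simp [hs, ht] at hA hB hAB ⊢
    all_goals simp [*, Ne.symm]
  · obtain hs | hs | hs : τ s = 0 ∨ τ s = 1 ∨ τ s = 2 := by omega
    all_goals obtain ht | ht | ht : τ t = 0 ∨ τ t = 1 ∨ τ t = 2 := by omega
    all_goals simp [hs, ht, hat, hut, eq_comm]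
  · obtain hs | hs | hs : τ s = 0 ∨ τ s = 1 ∨ τ s = 2 := by omega
    all_goals obtain ht | ht | ht : τ t = 0 ∨ τ t = 1 ∨ τ t = 2 := by omega
    all_goals simp [hs, ht, hat, hut, au4, bu4, ub4]
    all_goals (clear * -; intro w; omega)
  · obtain hs | hs | hs : τ s = 0 ∨ τ s = 1 ∨ τ s = 2 := by omega
    all_goals obtain ht | ht | ht : τ t = 0 ∨ τ t = 1 ∨ τ t = 2 := by omega
    all_goals simp [hs, ht] at hCA hCB hch2 ⊢
    all_goals simp [IsChain, Item.last, *]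

end

section

variable {X : Type*} {n : ℕ} {opp m₀ m₁ q τ : ℕ → ℕ} {V : ℕ → X}

/-- With no items left, `tree` says that a triangle is placed if its parent is; the induction runs
along the queue. -/
theorem Pending.mem_of_nil (hq : IsDualTree n opp q n) {E : Set ℕ} {c : X}
    (h : Pending n opp q τ V E [] c) (i : ℕ) (hi : i < n) : q i / 3 ∈ E := by
  have hroot := h.root
  have htree := h.tree
  simp only [List.not_mem_nil, false_and, exists_false, or_false] at hroot htree
  induction i using Nat.strong_induction_on with
  | _ i ih =>
    rcases Nat.eq_zero_or_pos i with rfl | h0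
    · rw [hq.root]; exact hroot
    · rw [htree i hi h0]
      rcases hq.parent i hi h0 with h1 | ⟨j, hj, h1⟩
      · exact Or.inl h1
      · right
        have : opp (q i) / 3 = q j / 3 := by rcases h1 with h1 | h1 <;> simp [h1, nx_div]
        rw [this]
        exact ih j hj (hj.trans hi)

/-- The items at the start: the subtree entered through side 0, and the one across side 0. -/
def start (m₀ m₁ τ : ℕ → ℕ) : List Item :=
  ⟨0, 0, 1⟩ :: (if 1 ≤ τ 0 then
    if 2 ≤ τ 1 ∧ 2 ≤ τ 2 then [⟨0, m₀ 0, m₁ 0⟩] else [⟨0, m₁ 0, m₀ 0⟩] else [])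

/-- The root has no parent side, so a tree side at side 0 is a further branch. It is entered at the
corner where the path of the root's subtree ends: corner 0 if that path is closed, corner 1
otherwise. Being listed from the start, it needs the exemption `opp (q j) = 0` in `tree`. -/
theorem pending_start (hg : IsGluing n opp m₀ m₁ V) (hq : IsDualTree n opp q n)
    (hτ : IsTyping n opp q τ) : Pending n opp q τ V ∅ (start m₀ m₁ τ) (V 0) := by
  have hn := hq.pos
  have h0 : across m₀ m₁ 0 1 = m₀ 0 := by simp [across, nx]
  have h1 : across m₀ m₁ 1 0 = m₁ 0 := by simp [across, nx]
  have hs : side 0 1 = 0 := by simp [side, nx]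
  have hs' : side 1 0 = 0 := by simp [side, nx]
  have a01 : Adj 0 1 := by simp [Adj, nx]
  obtain ⟨b1, b2, b3, b4⟩ := hg.across_spec a01 (by omega) (by omega)
  obtain ⟨b1', b2', b3', b4'⟩ := hg.across_spec a01.symm (by omega) (by omega)
  have v0 := hg.vertex_across a01 (by omega) (by omega)
  have v1 := hg.vertex_across a01.symm (by omega) (by omega)
  simp only [h0, h1, hs, hs'] at b1 b2 b3 b4 b1' b2' b3' b4' v0 v1
  have hr : ∃ i < n, 0 = q i := ⟨0, hn, hq.root.symm⟩
  have hlast : (⟨0, 0, 1⟩ : Item).last τ = if 2 ≤ τ 1 ∧ 2 ≤ τ 2 then 0 else 1 := by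
    have h1 := hτ.le_two 1
    have h2 := hτ.le_two 2
    simp only [Item.last, hs, Closed, nx, true_and]
    congr 1
    norm_num
    omega
  have htree : ∀ j < n, 0 < j → (opp (q j) = 0 ↔ 1 ≤ τ 0 ∧ opp 0 / 3 = q j / 3) := by
    intro j hj hj0
    constructor
    · intro h2
      have := hτ.child j hj hj0
      rw [h2] at this
      refine ⟨by rw [this]; split_ifs <;> omega, ?_⟩
      rw [← h2, hg.opp_opp _ (hq.lt j hj)]
    · rintro ⟨h2, h3⟩
      obtain ⟨⟨k, hk, hk0, hk1, hk2⟩, -⟩ := hτ.spec hg hq h2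
      rw [hk1] at h3
      rw [hk2, hq.inj k hk j hj h3]
  by_cases hτ0 : 1 ≤ τ 0
  · obtain ⟨⟨k, hk, hk0, hk1, hk2⟩, -⟩ := hτ.spec hg hq hτ0
    have hne : opp 0 / 3 ≠ 0 := by
      intro h2
      have := hq.inj k hk 0 hn (by rw [← hk1, h2, hq.root])
      omega
    have hQ : ∃ i < n, opp 0 = q i := ⟨k, hk, hk1⟩
    have htree' : ∀ j < n, 0 < j → (0 = q j / 3 ∨ opp 0 / 3 = q j / 3 ↔ opp (q j) = 0) := by
      intro j hj hj0
      rw [htree j hj hj0]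
      constructor
      · rintro (h2 | h2)
        · have := hq.inj 0 hn j hj (by rw [hq.root, ← h2])
          omega
        · exact ⟨hτ0, h2⟩
      · exact fun h2 => Or.inr h2.2
    unfold start
    rw [if_pos hτ0]
    by_cases hc : 2 ≤ τ 1 ∧ 2 ≤ τ 2
    · rw [if_pos hc]
      rw [if_pos hc] at hlast
      constructor <;>
        simp [hlast, IsChain, b3, b3', b1, b1', b2, b2', b4, b4', v0, v1, hQ, hs, hr, a01, hne.symm,
          hn, Set.mem_empty_iff_false] <;> omega
    · rw [if_neg hc]
      rw [if_neg hc] at hlast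
      constructor <;>
        simp [hlast, IsChain, b3, b3', b1, b1', b2, b2', b4, b4', v0, v1, hQ, hs, hr, a01, hne.symm,
          hn, Set.mem_empty_iff_false] <;> omega
  · have htree' : ∀ j < n, 0 < j → (0 = q j / 3 ↔ opp (q j) = 0) := by
      intro j hj hj0
      rw [htree j hj hj0]
      constructor
      · intro h2
        have := hq.inj 0 hn j hj (by rw [hq.root, ← h2])
        omega
      · exact fun h2 => absurd h2.1 hτ0
    unfold start
    rw [if_neg hτ0]
    constructor <;> simp [IsChain, hs, hr, a01, Set.mem_empty_iff_false] <;>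
      omega

end

/-! ### The program: tables -/

open Program NatExp

local infixr:60 " ⨟ " => Program.seq

/-- The number of corners. -/
def corners : NatExp := .add (.add (.var 0) (.var 0)) (.var 0)

/-- Writes a table of the successors of the corners to array 3. -/
def nxLoop : Program :=
  .while (.not (.natLe corners (.var 10)))
    (.setNat 3 (.var 10) (.add (.var 10) (.const 1)) ⨟
     .setNat 3 (.add (.var 10) (.const 1)) (.add (.var 10) (.const 2)) ⨟
     .setNat 3 (.add (.var 10) (.const 2)) (.var 10) ⨟
     .assign 10 (.add (.var 10) (.const 3)))

theorem runs_nxLoop {W N n : ℕ} {m : Mem} (hW : 3 * n ≤ W) (hN : n ≤ N) (h0 : m.nat 0 0 = n)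
    (h10 : m.nat 10 0 = 0) : Runs W N nxLoop m (fun m' => ∀ k < 3 * n, m'.nat 3 k = nx k) := by
  refine (runs_while (fun m => ∃ t ≤ n, m.nat 10 0 = 3 * t ∧ ∀ k < 3 * t, m.nat 3 k = nx k)
    (fun m => n - m.nat 10 0 / 3) ⟨0, by omega, by omega, by omega⟩ (by omega) ?_).mono ?_
  · rintro m' ⟨t, ht, h1, h2⟩ hf - h3
    have h0' : m'.nat 0 0 = n := by rw [hf 0 (by decide), h0]
    simp only [corners, Test.Holds, NatExp.eval, h0', h1] at h3
    have ht' : t < n := by omega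
    refine ⟨?_, ⟨t + 1, ht', ?_, ?_⟩, ?_⟩
    · simp [Ok, den, NatExp.eval, h1]
      omega
    · simp [den, NatExp.eval, h1]
      omega
    · intro k hk
      simp [den, NatExp.eval, h1]
      have := h2 k
      unfold nx at this ⊢
      split_ifs <;> split_ifs at this <;> omega
    · simp [den, NatExp.eval, h1]
      omega
  · rintro m' ⟨⟨t, ht, h1, h2⟩, h3, hf, -⟩ k hk
    have h0' : m'.nat 0 0 = n := by rw [hf 0 (by decide), h0]
    simp only [corners, Test.Holds, NatExp.eval, h0', h1] at h3
    exact h2 k (by omega)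

/-- Writes tables of the corners glued to the ends of the sides to the arrays 13 and 14. -/
def glueLoop : Program :=
  .assign 10 (.const 0) ⨟
  .while (.not (.natLe corners (.var 10)))
    (.ite (.natLe (.load 2 (.var 10)) (.const 0))
      (.setNat 13 (.var 10) (.load 1 (.var 10)) ⨟
       .setNat 14 (.var 10) (.load 3 (.load 1 (.var 10))))
      (.setNat 13 (.var 10) (.load 3 (.load 1 (.var 10))) ⨟
       .setNat 14 (.var 10) (.load 1 (.var 10))) ⨟
     .assign 10 (.add (.var 10) (.const 1)))

theorem runs_glueLoop {W N n : ℕ} {m : Mem} (hW : 3 * n ≤ W) (hN : 3 * n ≤ N) (h0 : m.nat 0 0 = n)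
    (h1 : ∀ k < 3 * n, m.nat 1 k < 3 * n) (h3 : ∀ k < 3 * n, m.nat 3 k = nx k) :
    Runs W N glueLoop m (fun m' => ∀ k < 3 * n,
      m'.nat 13 k = (if m.nat 2 k = 0 then m.nat 1 k else nx (m.nat 1 k)) ∧
      m'.nat 14 k = (if m.nat 2 k = 0 then nx (m.nat 1 k) else m.nat 1 k)) := by
  refine Runs.seq (Ok.runs (Q := fun m' => m' = m.setNat 10 0 0) ⟨Nat.zero_le _, Nat.zero_le _⟩ rfl)
    fun m₁ hm₁ => ?_
  have hm (a : ℕ) (ha : a ≠ 10) : m₁.nat a = m.nat a := by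
    rw [hm₁, Mem.nat_setNat_of_ne _ _ _ ha]
  refine (runs_while (fun m' => ∃ t ≤ 3 * n, m'.nat 10 0 = t ∧ ∀ k < t,
      m'.nat 13 k = (if m.nat 2 k = 0 then m.nat 1 k else nx (m.nat 1 k)) ∧
      m'.nat 14 k = (if m.nat 2 k = 0 then nx (m.nat 1 k) else m.nat 1 k))
    (fun m => 3 * n - m.nat 10 0) ⟨0, by omega, by simp [hm₁], by omega⟩ (by omega) ?_).mono ?_
  · rintro m' ⟨t, ht, ht', h2⟩ hf - hb
    have hf' (a : ℕ) (ha : a ∉ [13, 14, 13, 14, 10]) : m'.nat a = m.nat a := by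
      rw [hf a ha, hm a (by rintro rfl; simp at ha)]
    have f0 := hf' 0 (by decide)
    have f1 := hf' 1 (by decide)
    have f2 := hf' 2 (by decide)
    have f3 := hf' 3 (by decide)
    simp only [corners, Test.Holds, NatExp.eval, f0, h0, ht'] at hb
    have h1' := h1 t (by omega)
    have h3' := h3 _ h1'
    have hnx := nx_lt h1'
    refine ⟨?_, ⟨t + 1, by omega, ?_, ?_⟩, ?_⟩
    · simp [Ok, den, NatExp.eval, Test.Holds, f1, f2, f3, ht', h3']
      split_ifs <;> simp [ht'] <;> omega
    · simp [den, NatExp.eval, Test.Holds, f1, f2, f3, ht', h3']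
      split_ifs <;> simp [ht']
    · intro k hk
      simp [den, NatExp.eval, Test.Holds, f1, f2, f3, ht', h3']
      rcases Nat.lt_succ_iff_lt_or_eq.1 hk with hk | rfl
      · have := h2 k hk
        by_cases c1 : m.nat 2 t = 0 <;> simp [c1, hk.ne, this]
      · split_ifs with c1 <;> simp [h3']
    · simp [den, NatExp.eval, Test.Holds, f1, f2, f3, ht', h3']
      split_ifs <;> simp [ht'] <;> omega
  · rintro m' ⟨⟨t, ht, ht', h2⟩, hb, hf, -⟩ k hk
    have h0' : m'.nat 0 0 = n := by rw [hf 0 (by decide), hm 0 (by decide), h0]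
    simp only [corners, Test.Holds, NatExp.eval, h0', ht'] at hb
    exact h2 k (by omega)

/-! ### The program: breadth-first search in the dual graph -/

/-- Marks the triangle of the side `f` in variable 12, and appends `f` to the queue. -/
def visit : Program :=
  .setNat 4 (.var 12) (.const 1) ⨟
  .setNat 4 (.load 3 (.var 12)) (.const 1) ⨟
  .setNat 4 (.load 3 (.load 3 (.var 12))) (.const 1) ⨟
  .setNat 5 (.var 11) (.var 12) ⨟
  .assign 11 (.add (.var 11) (.const 1))

/-- Visits the triangle across the side `s` if it is new. -/
def explore (s : NatExp) : Program :=
  .assign 12 (.load 1 s) ⨟ .ite (.natLe (.load 4 (.var 12)) (.const 0)) visit .skip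

/-- The tables of the surface, in memory. -/
structure HasTables (n : ℕ) (opp : ℕ → ℕ) (m : Mem) : Prop where
  size : m.nat 0 0 = n
  mate : ∀ k < 3 * n, m.nat 1 k = opp k
  next : ∀ k < 3 * n, m.nat 3 k = nx k

/-- The invariant of the search. -/
structure Searching (n : ℕ) (opp : ℕ → ℕ) (m : Mem) : Prop extends HasTables n opp m where
  tree : IsDualTree n opp (m.nat 5) (m.nat 11 0)
  visited : ∀ k < 3 * n, m.nat 4 k = 0 ↔ ∀ i < m.nat 11 0, m.nat 5 i / 3 ≠ k / 3

theorem IsDualTree.snoc {n : ℕ} {opp q q' : ℕ → ℕ} {L f : ℕ} (h : IsDualTree n opp q L)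
    (hq : ∀ i < L, q' i = q i) (hf : q' L = f) (hfn : f < 3 * n) (hnew : ∀ i < L, q i / 3 ≠ f / 3)
    (hpar : opp f = 0 ∨ ∃ j < L, opp f = nx (q j) ∨
      opp f = nx (nx (q j))) : IsDualTree n opp q' (L + 1) where
  pos := L.succ_pos
  root := by rw [hq 0 h.pos, h.root]
  lt i hi := by
    rcases Nat.lt_succ_iff_lt_or_eq.1 hi with hi | rfl
    · rw [hq i hi]; exact h.lt i hi
    · rwa [hf]
  inj i hi j hj hij := by
    rcases Nat.lt_succ_iff_lt_or_eq.1 hi with hi | rfl <;>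
      rcases Nat.lt_succ_iff_lt_or_eq.1 hj with hj | rfl
    · rw [hq i hi, hq j hj] at hij
      exact h.inj i hi j hj hij
    · rw [hq i hi, hf] at hij
      exact absurd hij (hnew i hi)
    · rw [hq j hj, hf] at hij
      exact absurd hij.symm (hnew j hj)
    · rfl
  parent i hi hi0 := by
    rcases Nat.lt_succ_iff_lt_or_eq.1 hi with hi | rfl
    · rw [hq i hi]
      rcases h.parent i hi hi0 with h1 | ⟨j, hj, h1⟩
      · exact Or.inl h1
      · exact Or.inr ⟨j, hj, by rwa [hq j (hj.trans hi)]⟩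
    · rw [hf]
      rcases hpar with h1 | ⟨j, hj, h1⟩
      · exact Or.inl h1
      · exact Or.inr ⟨j, hj, by rwa [hq j hj]⟩

/-- Marks are written at all three corners of a triangle, so testing the single cell `opp s` decides
whether that triangle is new. The queue receives its entry side `opp s`. -/
theorem Searching.explore {n W : ℕ} {opp : ℕ → ℕ} {m : Mem} (h : Searching n opp m)
    (hW : 3 * n ≤ W) {e : NatExp} {s : ℕ} (he : e.eval m = s) (hs : s < 3 * n) (ho : opp s < 3 * n)
    (hoo : opp (opp s) = s) (hpar : s = 0 ∨ ∃ j < m.nat 11 0, s = nx (m.nat 5 j) ∨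
      s = nx (nx (m.nat 5 j))) {m' : Mem}
    (hm' : (explore e).den m = m') :
    (explore e).Ok W m ∧ Searching n opp m' ∧ m.nat 11 0 ≤ m'.nat 11 0 ∧
      (∀ i < m.nat 11 0, m'.nat 5 i = m.nat 5 i) ∧
      (∃ i < m'.nat 11 0, m'.nat 5 i / 3 = opp s / 3) := by
  have ho' := h.mate s hs
  have hn := h.next _ ho
  have hn1 := nx_lt ho
  have hn' := h.next _ hn1
  have hn2 := nx_lt hn1
  have hvis := h.visited _ ho
  have hLn := h.tree.le
  have f0 : m'.nat 0 = m.nat 0 := by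
    rw [← hm']; exact nat_den m (by simp [natWrites, VertexUnfolding.explore, visit])
  have f1 : m'.nat 1 = m.nat 1 := by
    rw [← hm']; exact nat_den m (by simp [natWrites, VertexUnfolding.explore, visit])
  have f3 : m'.nat 3 = m.nat 3 := by
    rw [← hm']; exact nat_den m (by simp [natWrites, VertexUnfolding.explore, visit])
  have ht : HasTables n opp m' := ⟨by rw [f0, h.size], by rw [f1]; exact h.mate, by
    rw [f3]; exact h.next⟩
  by_cases hv : m.nat 4 (opp s) = 0
  · have hnew := hvis.1 hv
    have h5 : ∀ i, m'.nat 5 i = if i = m.nat 11 0 then opp s else m.nat 5 i := by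
      intro i
      simp [← hm', VertexUnfolding.explore, visit, den, NatExp.eval, Test.Holds, he, ho', hv, hn]
    have h11 : m'.nat 11 0 = m.nat 11 0 + 1 := by
      simp [← hm', VertexUnfolding.explore, visit, den, NatExp.eval, Test.Holds, he, ho', hv, hn]
    have h4 : ∀ k, m'.nat 4 k = if k / 3 = opp s / 3 then 1 else m.nat 4 k := by
      intro k
      simp [← hm', VertexUnfolding.explore, visit, den, NatExp.eval, Test.Holds, he, ho', hv, hn,
        hn', div_eq_iff_nx]
      split_ifs <;> tauto
    have htree := h.tree.snoc (q' := m'.nat 5) (f := opp s) (fun i hi => by rw [h5, if_neg hi.ne])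
      (by rw [h5, if_pos rfl]) ho hnew (by rwa [hoo])
    refine ⟨?_, ⟨ht, by rwa [h11], ?_⟩, by omega, fun i hi => by rw [h5, if_neg hi.ne], ?_⟩
    · have := h.tree.le
      simp [VertexUnfolding.explore, visit, Ok, den, NatExp.eval, Test.Holds, he, ho', hv, hn, hn']
      omega
    · intro k hk
      have := h.visited k hk
      rw [h4, h11]
      constructor
      · intro h6 i hi
        rw [h5]
        split_ifs at h6 with h7
        rcases Nat.lt_succ_iff_lt_or_eq.1 hi with hi | rfl
        · rw [if_neg hi.ne]
          exact this.1 h6 i hi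
        · rw [if_pos rfl]
          exact Ne.symm h7
      · intro h6
        have h7 := h6 _ (Nat.lt_succ_self _)
        rw [h5, if_pos rfl] at h7
        rw [if_neg (Ne.symm h7), this]
        intro i hi
        have h8 := h6 i (by omega)
        rwa [h5, if_neg hi.ne] at h8
    · exact ⟨m.nat 11 0, by omega, by rw [h5, if_pos rfl]⟩
  · have h5 : m'.nat 5 = m.nat 5 := by
      simp [← hm', VertexUnfolding.explore, visit, den, NatExp.eval, Test.Holds, he, ho', hv]
    have h11 : m'.nat 11 = m.nat 11 := by
      simp [← hm', VertexUnfolding.explore, visit, den, NatExp.eval, Test.Holds, he, ho', hv]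
    have h4 : m'.nat 4 = m.nat 4 := by
      simp [← hm', VertexUnfolding.explore, visit, den, NatExp.eval, Test.Holds, he, ho', hv]
    refine ⟨?_, ⟨ht, ?_, ?_⟩, ?_, ?_, ?_⟩
    · simp [VertexUnfolding.explore, visit, Ok, den, NatExp.eval, Test.Holds, he, ho', hv]
      omega
    · rw [h5, h11]; exact h.tree
    · rw [h4, h5, h11]; exact h.visited
    · rw [h11]
    · simp [h5]
    · rw [h5, h11]
      simpa using mt hvis.2 hv

/-- Initializes the search: the queue holds side 0, whose triangle is marked. -/
def initSearch : Program :=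
  .setNat 4 (.const 0) (.const 1) ⨟
  .setNat 4 (.const 1) (.const 1) ⨟
  .setNat 4 (.const 2) (.const 1) ⨟
  .assign 11 (.const 1) ⨟
  .assign 10 (.const 0)

/-- The main loop of the search. -/
def searchLoop : Program :=
  .while (.not (.natLe (.var 11) (.var 10)))
    (explore (.load 3 (.load 5 (.var 10))) ⨟
     explore (.load 3 (.load 3 (.load 5 (.var 10)))) ⨟
     .assign 10 (.add (.var 10) (.const 1)))

/-- The neighbour across the entry side of a queued triangle is its parent, and the two other sides
are explored when the triangle is dequeued. At the end the queued triangles are therefore closed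
under adjacency, and by `hconn` they are all triangles. -/
theorem runs_search {n W N : ℕ} {opp : ℕ → ℕ} {m : Mem} (hn : 0 < n) (hW : 3 * n ≤ W) (hN : n ≤ N)
    (h : HasTables n opp m) (ho : ∀ s < 3 * n, opp s < 3 * n)
    (hoo : ∀ s < 3 * n, opp (opp s) = s) (h4 : ∀ k, m.nat 4 k = 0) (h5 : ∀ k, m.nat 5 k = 0)
    (hconn : ∀ S : Set ℕ, 0 ∈ S → (∀ s < 3 * n, s / 3 ∈ S → opp s / 3 ∈ S) → ∀ t < n, t ∈ S) :
    Runs W N (initSearch ⨟ explore (.const 0) ⨟ searchLoop) m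
      (fun m' => IsDualTree n opp (m'.nat 5) n ∧ ∀ t < n, ∃ i < n, m'.nat 5 i / 3 = t) := by
  refine Runs.seq (Q := fun m' => Searching n opp m' ∧ m'.nat 11 0 = 1 ∧ m'.nat 10 0 = 0)
    (Ok.runs ?_ ?_) fun m₁ ⟨hm₁, h11, h10⟩ => ?_
  · simp [initSearch, Ok, den, NatExp.eval]
    omega
  · refine ⟨⟨⟨?_, ?_, ?_⟩, ?_, ?_⟩, ?_, ?_⟩
    · simp [initSearch, den, NatExp.eval, h.size]
    · simpa [initSearch, den, NatExp.eval] using h.mate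
    · simpa [initSearch, den, NatExp.eval] using h.next
    · simp [initSearch, den, NatExp.eval]
      constructor
      all_goals simp [h5]
      omega
    · intro k hk
      have : k / 3 = 0 ↔ k = 0 ∨ k = 1 ∨ k = 2 := by omega
      simp [initSearch, den, NatExp.eval, h5, h4, eq_comm (a := 0), this]
      split_ifs <;> simp_all
    · simp [initSearch, den, NatExp.eval]
    · simp [initSearch, den, NatExp.eval]
  -- Side 0 is explored separately: it is the entry side of the root, but no parent lies across it,
  -- and the loop handles non-entry sides only.
  obtain ⟨e1, e2, e3, e4, e5⟩ := hm₁.explore hW (e := .const 0) (s := 0) rfl (by omega)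
    (ho _ (by omega)) (hoo _ (by omega)) (Or.inl rfl) rfl
  refine Runs.seq (Q := fun m' => Searching n opp m' ∧ m'.nat 10 0 = 0 ∧
    ∃ i < m'.nat 11 0, m'.nat 5 i / 3 = opp 0 / 3) (Ok.runs e1 ⟨e2, ?_, e5⟩)
    fun m₂ ⟨hm₂, k10, k0⟩ => ?_
  · rw [nat_den _ (by decide), h10]
  refine (runs_while (fun m' => Searching n opp m' ∧ m'.nat 10 0 ≤ m'.nat 11 0 ∧
    (∃ i < m'.nat 11 0, m'.nat 5 i / 3 = opp 0 / 3) ∧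
    ∀ i < m'.nat 10 0, ∀ s, (s = nx (m'.nat 5 i) ∨ s = nx (nx (m'.nat 5 i))) →
      ∃ j < m'.nat 11 0, m'.nat 5 j / 3 = opp s / 3) (fun m' => n - m'.nat 10 0)
    ⟨hm₂, by omega, k0, by omega⟩ (by omega) ?_).mono ?_
  · rintro m' ⟨a1, a2, a3, a4⟩ - - hb
    simp only [Test.Holds, NatExp.eval, not_le] at hb
    have hL := a1.tree.le
    set h := m'.nat 10 0 with hh
    have hq := a1.tree.lt h hb
    have hq1 := nx_lt hq
    have hq2 := nx_lt hq1
    obtain ⟨b1, b2, b3, b4, b5⟩ := a1.explore (m' := (explore (.load 3 (.load 5 (.var 10)))).den m')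
      hW (e := .load 3 (.load 5 (.var 10)))
      (s := nx (m'.nat 5 h)) (by simp [NatExp.eval, ← hh, a1.next _ hq]) hq1 (ho _ hq1) (hoo _ hq1)
      (Or.inr ⟨h, hb, Or.inl rfl⟩) rfl
    have b10 : ((explore (.load 3 (.load 5 (.var 10)))).den m').nat 10 = m'.nat 10 :=
      nat_den _ (by decide)
    set m2 := (explore (.load 3 (.load 5 (.var 10)))).den m'
    have b4' := b4 h hb
    have c0 : NatExp.eval m2 (.load 3 (.load 3 (.load 5 (.var 10)))) = nx (nx (m'.nat 5 h)) := by
      simp [NatExp.eval, b10, ← hh, b4', b2.next _ hq, b2.next _ hq1]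
    obtain ⟨c1, c2, c3, c4, c5⟩ := b2.explore
      (m' := (explore (.load 3 (.load 3 (.load 5 (.var 10))))).den m2)
      hW c0 hq2 (ho _ hq2) (hoo _ hq2) (Or.inr ⟨h, by omega, Or.inr (by rw [b4'])⟩) rfl
    have c10 : ((explore (.load 3 (.load 3 (.load 5 (.var 10))))).den m2).nat 10 = m2.nat 10 :=
      nat_den _ (by decide)
    rw [den, den, Ok, Ok]
    set m3 := (explore (.load 3 (.load 3 (.load 5 (.var 10))))).den m2
    have d10 : m3.nat 10 0 = h := by rw [c10, b10]
    have hq' : ∀ i < m'.nat 11 0, m3.nat 5 i = m'.nat 5 i := fun i hi => by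
      rw [c4 i (by omega), b4 i hi]
    have hL3 := c2.tree.le
    have hold : ∀ s, (∃ j < m'.nat 11 0, m'.nat 5 j / 3 = s) → ∃ j < m3.nat 11 0, m3.nat 5 j / 3 = s :=
      fun s ⟨j, hj, h'⟩ => ⟨j, by omega, by rw [hq' j hj, h']⟩
    have dd : (Program.assign 10 (.add (.var 10) (.const 1))).den m3 = m3.setNat 10 0 (h + 1) := by
      simp [den, NatExp.eval, d10]
    rw [dd]
    simp only [Mem.nat_setNat_self, if_true, Mem.nat_setNat_of_ne m3 (a := 10) (b := 5) _ _ (by decide),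
      Mem.nat_setNat_of_ne m3 (a := 10) (b := 11) _ _ (by decide)]
    refine ⟨⟨b1, c1, ?_⟩, ⟨?_, by omega, hold _ a3, ?_⟩, by omega⟩
    · simp [Ok, NatExp.eval, d10]
      omega
    · refine ⟨⟨?_, ?_, ?_⟩, ?_, ?_⟩ <;> simp
      · exact c2.size
      · exact c2.mate
      · exact c2.next
      · exact c2.tree
      · exact c2.visited
    · intro i hi s hs
      rw [hq' i (by omega)] at hs
      rcases Nat.lt_succ_iff_lt_or_eq.1 hi with hi | rfl
      · exact hold _ (a4 i hi s hs)
      · rcases hs with rfl | rfl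
        · obtain ⟨j, hj, h'⟩ := b5
          exact ⟨j, by omega, by rw [c4 j hj, h']⟩
        · exact c5
  · rintro m' ⟨⟨a1, a2, a3, a4⟩, hb, -⟩
    simp only [Test.Holds, NatExp.eval, not_not] at hb
    have hL := a1.tree.le
    have hall := hconn {t | ∃ i < m'.nat 11 0, m'.nat 5 i / 3 = t} ⟨0, a1.tree.pos, by
      rw [a1.tree.root]⟩ (by
      rintro s hs ⟨i, hi, his⟩
      rw [eq_comm, div_eq_iff_nx] at his
      rcases his with rfl | his
      · rcases Nat.eq_zero_or_pos i with rfl | hi0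
        · rw [a1.tree.root]; exact a3
        · rcases a1.tree.parent i hi hi0 with h1 | ⟨j, hj, h1⟩
          · exact ⟨0, a1.tree.pos, by rw [a1.tree.root, h1]⟩
          · exact ⟨j, by omega, by rcases h1 with h1 | h1 <;> rw [h1] <;> simp only [nx_div]⟩
      · exact a4 i (by omega) s his)
    -- No triangle is queued twice and none is missed.
    have hLn : m'.nat 11 0 = n := by
      refine le_antisymm hL ?_
      have := Finset.card_le_card_of_surjOn (s := Finset.range (m'.nat 11 0)) (t := Finset.range n)
        (fun i => m'.nat 5 i / 3) (by
          intro t ht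
          obtain ⟨i, hi, h'⟩ := hall t (by simpa using ht)
          exact ⟨i, by simpa using hi, h'⟩)
      simpa using this
    rw [hLn] at hall
    exact ⟨hLn ▸ a1.tree, hall⟩

/-! ### The program: types of the subtrees -/

/-- Determines the type of the subtree that precedes the current one in the queue. -/
def typingStep : Program :=
  .assign 10 (.sub (.var 10) (.const 1)) ⨟
  .ite (.and (.natLe (.const 2) (.load 6 (.load 3 (.load 5 (.var 10)))))
      (.natLe (.const 2) (.load 6 (.load 3 (.load 3 (.load 5 (.var 10)))))))
    (.setNat 6 (.load 1 (.load 5 (.var 10))) (.const 1))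
    (.setNat 6 (.load 1 (.load 5 (.var 10))) (.const 2))

/-- Determines the types of the subtrees, from the leaves to the root. -/
def typing : Program :=
  .assign 10 (.var 0) ⨟ .while (.not (.natLe (.var 10) (.const 1))) typingStep

-- Children come later in the queue than their parents, so a backward pass finds the types of all
-- children final. It stops before entry 0, since the root has no type to report to a parent.
open Classical in
theorem runs_typing {n W N : ℕ} {opp q : ℕ → ℕ} {m : Mem} (hn : 0 < n) (hW : 3 * n ≤ W) (hN : n ≤ N)
    (h : HasTables n opp m) (ho : ∀ s < 3 * n, opp s < 3 * n)
    (hoo : ∀ s < 3 * n, opp (opp s) = s) (hq : IsDualTree n opp q n)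
    (h5 : m.nat 5 = q) (h6 : ∀ k, m.nat 6 k = 0) :
    Runs W N typing m (fun m' => IsTyping n opp q (m'.nat 6)) := by
  refine Runs.seq (Q := fun m' => m' = m.setNat 10 0 n) (Ok.runs ?_ ?_) fun m₁ hm₁ => ?_
  · simp [Ok, NatExp.eval, h.size]
    omega
  · simp [den, NatExp.eval, h.size]
  have hm (a : ℕ) (ha : a ≠ 10) : m₁.nat a = m.nat a := by
    rw [hm₁, Mem.nat_setNat_of_ne _ _ _ ha]
  refine (runs_while (fun m' => 1 ≤ m'.nat 10 0 ∧ m'.nat 10 0 ≤ n ∧ (∀ s, m'.nat 6 s ≤ 2) ∧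
      (∀ i < n, m'.nat 10 0 ≤ i →
        m'.nat 6 (opp (q i)) = if Closed (m'.nat 6) (q i) then 1 else 2) ∧
      ∀ s, (∀ i < n, m'.nat 10 0 ≤ i → s ≠ opp (q i)) → m'.nat 6 s = 0)
    (fun m => m.nat 10 0) ?_ (by simpa [hm₁]) ?_).mono ?_
  · simp only [hm₁, Mem.nat_setNat_self, if_true]
    refine ⟨hn, le_rfl, ?_, fun i hi hi' => absurd hi hi'.not_gt, ?_⟩ <;> simp [h6]
  · rintro m' ⟨a1, a2, a3, a4, a5⟩ hf - hb
    simp only [Test.Holds, NatExp.eval, not_le] at hb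
    obtain ⟨k, hk⟩ : ∃ k, m'.nat 10 0 = k + 1 := ⟨m'.nat 10 0 - 1, by omega⟩
    have f1 : m'.nat 1 = m.nat 1 := by rw [hf 1 (by decide), hm 1 (by decide)]
    have f3 : m'.nat 3 = m.nat 3 := by rw [hf 3 (by decide), hm 3 (by decide)]
    have f5 : m'.nat 5 = q := by rw [hf 5 (by decide), hm 5 (by decide), h5]
    have hk0 : 0 < k := by omega
    have hqk := hq.lt k (by omega)
    have hmate : m'.nat 1 (q k) = opp (q k) := by rw [f1, h.mate _ hqk]
    have hn1 : m'.nat 3 (q k) = nx (q k) := by rw [f3, h.next _ hqk]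
    have hn2 : m'.nat 3 (nx (q k)) = nx (nx (q k)) := by rw [f3, h.next _ (nx_lt hqk)]
    rw [hk] at a4 a5 a2
    have hok := ho _ hqk
    have hcl : (2 ≤ m'.nat 6 (nx (q k)) ∧ 2 ≤ m'.nat 6 (nx (nx (q k)))) ↔
        Closed (m'.nat 6) (q k) := by
      have b1 := a3 (nx (q k))
      have b2 := a3 (nx (nx (q k)))
      unfold Closed
      omega
    have hok : typingStep.Ok W m' := by
      simp [typingStep, Ok, den, NatExp.eval, Test.Holds, hk, f5, hn1, hn2, hmate]
      omega
    have e10 : (typingStep.den m').nat 10 0 = k := by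
      simp [typingStep, den, NatExp.eval, Test.Holds, hk, f5, hn1, hn2, hmate]
      split_ifs <;> simp
    have e6 : ∀ s, (typingStep.den m').nat 6 s = if s = opp (q k) then
        if Closed (m'.nat 6) (q k) then 1 else 2 else m'.nat 6 s := by
      intro s
      rw [← hcl]
      simp [typingStep, den, NatExp.eval, Test.Holds, hk, f5, hn1, hn2, hmate]
      by_cases c1 : 2 ≤ m'.nat 6 (nx (q k)) ∧ 2 ≤ m'.nat 6 (nx (nx (q k))) <;> simp [c1]
    generalize typingStep.den m' = m2 at *
    -- The cell `opp (q k)` written in this round belongs to the triangle of an earlier entry, so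
    -- `Closed` is unchanged for entry `k` and all later ones.
    have hpar : ∀ j, k ≤ j → j < n → ∀ s, (s = nx (q j) ∨ s = nx (nx (q j))) →
        s ≠ opp (q k) := by
      intro j hj hjn s hs hs'
      have hs3 : s / 3 = q j / 3 := by rcases hs with rfl | rfl <;> simp [nx_div]
      rcases hq.parent k (by omega) hk0 with h1 | ⟨i, hi, h1⟩
      · have := hq.inj j hjn 0 hn (by rw [← hs3, hs', h1, hq.root])
        omega
      · have := hq.inj j hjn i (by omega) (by
          rw [← hs3, hs']; rcases h1 with h1 | h1 <;> simp [h1, nx_div])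
        omega
    have hcl2 : ∀ j, k ≤ j → j < n → (Closed (m2.nat 6) (q j) ↔ Closed (m'.nat 6) (q j)) := by
      intro j hj hjn
      unfold Closed
      rw [e6, e6, if_neg (hpar j hj hjn _ (Or.inl rfl)),
        if_neg (hpar j hj hjn _ (Or.inr rfl))]
    rw [hk, e10]
    refine ⟨hok, ⟨by omega, by omega, ?_, ?_, ?_⟩, by omega⟩
    · intro s
      rw [e6]
      have := a3 s
      split_ifs <;> omega
    · intro j hj hkj
      rw [e6]
      rcases Nat.eq_or_lt_of_le hkj with rfl | hkj'
      · rw [if_pos rfl]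
        simp only [hcl2 k le_rfl hj]
      · rw [if_neg, a4 j hj hkj']
        · simp only [hcl2 j hkj hj]
        intro h1
        have := hoo _ (hq.lt j hj)
        rw [h1, hoo _ hqk] at this
        have := hq.inj k (by omega) j hj (by rw [this])
        omega
    · intro s hs
      rw [e6, if_neg (hs k (by omega) le_rfl)]
      exact a5 s fun i hi hki => hs i hi (by omega)
  · rintro m' ⟨⟨a1, a2, a3, a4, a5⟩, hb, -⟩
    simp only [Test.Holds, NatExp.eval, not_not] at hb
    exact ⟨fun i hi h0 => a4 i hi (by omega), fun s hs => a5 s fun i hi h0 => hs i hi (by omega)⟩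

/-! ### The program: the stack of pending items -/

/-- The arrays `A`, `B`, `C` hold the items in `l`, the first one on top. -/
def IsStack (A B C : ℕ → ℕ) : List Item → Prop
  | [] => True
  | x :: l => A l.length = x.tag ∧ B l.length = x.a ∧ C l.length = x.b ∧ IsStack A B C l

/-- The stack in memory. -/
def HasStack (m : Mem) (l : List Item) : Prop :=
  m.nat 15 0 = l.length ∧ IsStack (m.nat 7) (m.nat 8) (m.nat 9) l

theorem IsStack.congr {A B C A' B' C' : ℕ → ℕ} : ∀ {l : List Item}, IsStack A B C l →
    (∀ i < l.length, A' i = A i ∧ B' i = B i ∧ C' i = C i) → IsStack A' B' C' l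
  | [], _, _ => trivial
  | x :: l, ⟨h1, h2, h3, h4⟩, h => by
    obtain ⟨e1, e2, e3⟩ := h l.length (by simp)
    exact ⟨e1.trans h1, e2.trans h2, e3.trans h3, h4.congr fun i hi => h i (by simp; omega)⟩

theorem HasStack.congr {m m' : Mem} {l : List Item} (h : HasStack m l)
    (e : ∀ a ∈ [7, 8, 9, 15], m'.nat a = m.nat a) : HasStack m' l := by
  unfold HasStack
  rwa [e 7 (by decide), e 8 (by decide), e 9 (by decide), e 15 (by decide)]

/-- Pushes the item with tag `t` whose corners are in the variables `p` and `q`. -/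
def push (t p q : ℕ) : Program :=
  .setNat 7 (.var 15) (.const t) ⨟
  .setNat 8 (.var 15) (.var p) ⨟
  .setNat 9 (.var 15) (.var q) ⨟
  .assign 15 (.add (.var 15) (.const 1))

theorem nat_push {t p q a : ℕ} (m : Mem) (ha : a ∉ [7, 8, 9, 15]) :
    ((push t p q).den m).nat a = m.nat a := nat_den m ha

theorem HasStack.push {m : Mem} {l : List Item} (h : HasStack m l) {t p q : ℕ}
    (hp : p ∉ [7, 8, 9, 15]) (hq : q ∉ [7, 8, 9, 15]) :
    HasStack ((push t p q).den m) (⟨t, m.nat p 0, m.nat q 0⟩ :: l) := by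
  obtain ⟨h1, h2⟩ := h
  simp only [List.mem_cons, List.not_mem_nil, or_false, not_or] at hp hq
  simp only [HasStack, IsStack, VertexUnfolding.push, den, NatExp.eval, Mem.nat_setNat_self, h1]
  simp [h1, hp, hq]
  refine h2.congr fun i hi => ?_
  simp [hi.ne]

theorem ok_push {W : ℕ} {m : Mem} {l : List Item} (h : HasStack m l) {t p q : ℕ}
    (hp : p ∉ [7, 8, 9, 15]) (hq : q ∉ [7, 8, 9, 15]) (hl : l.length + 1 ≤ W) (ht : t ≤ W)
    (hpW : m.nat p 0 ≤ W) (hqW : m.nat q 0 ≤ W) : (push t p q).Ok W m := by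
  obtain ⟨h1, h2⟩ := h
  simp only [List.mem_cons, List.not_mem_nil, or_false, not_or] at hp hq
  simp [push, Ok, den, NatExp.eval, h1, hp, hq]
  omega

/-- Is the corner in variable 17 the successor of that in variable 16? -/
def isNext : Test := .and (.natLe (.load 3 (.var 16)) (.var 17)) (.natLe (.var 17) (.load 3 (.var 16)))

/-- Computes, for the corners `a`, `b` in the variables 16 and 17, the third corner `u`, the sides
from `a` and `b` to `u`, and the corners across these sides. -/
def expandSetup : Program :=
  .ite isNext
    (.assign 19 (.load 3 (.var 17)) ⨟ .assign 20 (.var 19) ⨟ .assign 21 (.var 17) ⨟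
     .assign 22 (.load 14 (.var 19)) ⨟ .assign 23 (.load 13 (.var 19)) ⨟
     .assign 24 (.load 13 (.var 17)) ⨟ .assign 25 (.load 14 (.var 17)))
    (.assign 19 (.load 3 (.var 16)) ⨟ .assign 20 (.var 16) ⨟ .assign 21 (.var 19) ⨟
     .assign 22 (.load 13 (.var 16)) ⨟ .assign 23 (.load 14 (.var 16)) ⨟
     .assign 24 (.load 14 (.var 19)) ⨟ .assign 25 (.load 13 (.var 19)))

/-- Is there a subtree with a path between the ends of the side in variable `s`? -/
def isPath (s : ℕ) : Test := .natLe (.const 2) (.load 6 (.var s))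

/-- Is there a subtree across the side in variable `s`? -/
def isChild (s : ℕ) : Test := .natLe (.const 1) (.load 6 (.var s))

/-- Computes the corners where the path enters and leaves the triangle. -/
def expandEnds : Program :=
  .ite (isPath 20) (.assign 26 (.var 19)) (.assign 26 (.var 16)) ⨟
  .ite (isPath 21) (.assign 27 (.var 19)) (.assign 27 (.var 17))

/-- Pushes the items that replace a subtree, except for the first child. -/
def expandPush : Program :=
  .ite (.and (isPath 20) (isPath 21)) (push 1 17 16 ⨟ push 0 25 24)
    (.ite (isPath 21) (push 0 25 24) (.ite (isChild 21) (push 0 24 25) .skip) ⨟ push 1 26 27)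

/-- Replaces a subtree on the stack by its expansion. -/
def expandItem : Program :=
  expandSetup ⨟ expandEnds ⨟ expandPush ⨟ .ite (isChild 20) (push 0 22 23) .skip

section

variable {X : Type*} {n : ℕ} {opp : ℕ → ℕ} {V : ℕ → X}

theorem IsGluing.lt₀ {m₀ m₁ : ℕ → ℕ} (hg : IsGluing n opp m₀ m₁ V) {s : ℕ} (hs : s < 3 * n) :
    m₀ s < 3 * n := by
  have h1 := hg.opp_lt s hs
  have h2 := nx_lt h1
  rcases hg.ends s hs with h | h <;> omega

theorem IsGluing.lt₁ {m₀ m₁ : ℕ → ℕ} (hg : IsGluing n opp m₀ m₁ V) {s : ℕ} (hs : s < 3 * n) :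
    m₁ s < 3 * n := by
  have h1 := hg.opp_lt s hs
  have h2 := nx_lt h1
  rcases hg.ends s hs with h | h <;> omega

theorem expandSetup_spec {W : ℕ} {m : Mem} (hW : 3 * n ≤ W) (h : HasTables n opp m)
    (hg : IsGluing n opp (m.nat 13) (m.nat 14) V) {a b : ℕ} (ha : a < 3 * n) (hb : b < 3 * n)
    (hab : Adj a b) (ha' : m.nat 16 0 = a) (hb' : m.nat 17 0 = b) :
    expandSetup.Ok W m ∧
      (expandSetup.den m).nat 19 0 = third a b ∧
      (expandSetup.den m).nat 20 0 = side a (third a b) ∧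
      (expandSetup.den m).nat 21 0 = side b (third a b) ∧
      (expandSetup.den m).nat 22 0 = across (m.nat 13) (m.nat 14) a (third a b) ∧
      (expandSetup.den m).nat 23 0 = across (m.nat 13) (m.nat 14) (third a b) a ∧
      (expandSetup.den m).nat 24 0 = across (m.nat 13) (m.nat 14) b (third a b) ∧
      (expandSetup.den m).nat 25 0 = across (m.nat 13) (m.nat 14) (third a b) b := by
  have na := h.next a ha
  have nb := h.next b hb
  have la := nx_lt ha
  have lb := nx_lt hb
  have k1 := hg.lt₀ ha
  have k2 := hg.lt₁ ha
  have k3 := hg.lt₀ hb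
  have k4 := hg.lt₁ hb
  have k5 := hg.lt₀ la
  have k6 := hg.lt₁ la
  have k7 := hg.lt₀ lb
  have k8 := hg.lt₁ lb
  have htest : isNext.Holds m ↔ nx a = b := by
    simp only [isNext, Test.Holds, NatExp.eval, ha', hb', na]
    omega
  by_cases hc : nx a = b
  · have h1 : nx a ≠ nx b := by rw [hc]; exact (nx_ne b).symm
    have h2 : nx (nx b) = a := by rw [← hc, nx_nx_nx]
    have h3 : nx b ≠ b := nx_ne b
    have h4 : a ≠ b := by rw [← hc]; exact (nx_ne a).symm
    simp only [expandSetup, Ok, den, htest, if_pos hc]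
    simp [hc, NatExp.eval, ha', hb', na, nb, third, side, across, h1, h2, h3, h3.symm, h4, h4.symm]
    omega
  · have hc' : nx b = a := hab.resolve_left hc
    have h1 : nx b ≠ nx a := by rw [hc']; exact (nx_ne a).symm
    have h2 : nx (nx a) = b := by rw [← hc', nx_nx_nx]
    have h3 : nx a ≠ a := nx_ne a
    have h4 : b ≠ a := by rw [← hc']; exact (nx_ne b).symm
    simp only [expandSetup, Ok, den, htest, if_neg hc]
    simp [hc, NatExp.eval, ha', hb', na, nb, third, side, across, hc', h1, h2, h3, h3.symm, h4, h4.symm]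
    omega

/-- The first item has to end up on top, so the expansion is pushed from back to front, the subtree
across the side `au` last. -/
theorem expandItem_spec {W : ℕ} {m : Mem} (hW : 3 * n ≤ W) (h : HasTables n opp m)
    (hg : IsGluing n opp (m.nat 13) (m.nat 14) V) {a b : ℕ} (ha : a < 3 * n) (hb : b < 3 * n)
    (hab : Adj a b) (ha' : m.nat 16 0 = a) (hb' : m.nat 17 0 = b) {l : List Item}
    (hl : HasStack m l) (hlW : l.length + 3 ≤ W) :
    expandItem.Ok W m ∧
      HasStack (expandItem.den m) (expansion (m.nat 13) (m.nat 14) (m.nat 6) ⟨0, a, b⟩ ++ l) := by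
  obtain ⟨hok, e19, e20, e21, e22, e23, e24, e25⟩ := expandSetup_spec hW h hg ha hb hab ha' hb'
  have hau := adj_third_left hab
  have hbu := adj_third_right hab
  have hun : third a b < 3 * n := by
    have := hau.div_eq
    omega
  obtain ⟨-, -, b22, -⟩ := hg.across_spec hau ha hun
  obtain ⟨-, -, b23, -⟩ := hg.across_spec hau.symm hun ha
  obtain ⟨-, -, b24, -⟩ := hg.across_spec hbu hb hun
  obtain ⟨-, -, b25, -⟩ := hg.across_spec hbu.symm hun hb
  simp only [expandItem, expansion, Ok, den]
  have f16 : (expandSetup.den m).nat 16 0 = a := by rw [nat_den m (by decide), ha']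
  have f17 : (expandSetup.den m).nat 17 0 = b := by rw [nat_den m (by decide), hb']
  have f6 : (expandSetup.den m).nat 6 = m.nat 6 := nat_den m (by decide)
  have hl1 : HasStack (expandSetup.den m) l := hl.congr fun a ha => nat_den m (by
    revert a; decide)
  generalize expandSetup.den m = m1 at *
  generalize third a b = u at *
  generalize across (m.nat 13) (m.nat 14) a u = au at *
  generalize across (m.nat 13) (m.nat 14) u a = ua at *
  generalize across (m.nat 13) (m.nat 14) b u = bu at *
  generalize across (m.nat 13) (m.nat 14) u b = ub at *
  generalize side a u = s at *
  generalize side b u = t at *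
  generalize m.nat 6 = τ at *
  have hok2 : expandEnds.Ok W m1 := by
    simp only [expandEnds, Ok, den, NatExp.eval, e19, f16, f17]
    simp
    split_ifs <;> simp [e19, f17] <;> omega
  have e26 : (expandEnds.den m1).nat 26 0 = if 2 ≤ τ s then u else a := by
    simp only [expandEnds, den, isPath, Test.Holds, NatExp.eval, e20, e21, f6]
    split_ifs <;> simp [e19, f16]
  have e27 : (expandEnds.den m1).nat 27 0 = if 2 ≤ τ t then u else b := by
    simp only [expandEnds, den, isPath, Test.Holds, NatExp.eval, e20, e21, f6]
    split_ifs <;> simp_all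
  have fr : ∀ a, a ∉ [26, 26, 27, 27] → (expandEnds.den m1).nat a = m1.nat a :=
    fun a ha => nat_den m1 ha
  rw [← fr 20 (by decide)] at e20
  rw [← fr 21 (by decide)] at e21
  rw [← fr 22 (by decide)] at e22
  rw [← fr 23 (by decide)] at e23
  rw [← fr 24 (by decide)] at e24
  rw [← fr 25 (by decide)] at e25
  rw [← fr 16 (by decide)] at f16
  rw [← fr 17 (by decide)] at f17
  rw [← fr 6 (by decide)] at f6
  have hl2 : HasStack (expandEnds.den m1) l := hl1.congr fun a ha => fr a (by
    revert a; decide)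
  generalize expandEnds.den m1 = m2 at *
  clear fr
  -- the items after the first child
  obtain ⟨k, hk⟩ : ∃ k, k = (if 2 ≤ τ s ∧ 2 ≤ τ t then [(⟨0, ub, bu⟩ : Item), ⟨1, b, a⟩] else
    ⟨1, if 2 ≤ τ s then u else a, if 2 ≤ τ t then u else b⟩ ::
    (if 2 ≤ τ t then [⟨0, ub, bu⟩] else if 1 ≤ τ t then [⟨0, bu, ub⟩] else [])) := ⟨_, rfl⟩
  rw [← hk]
  have hsplit : expandPush.Ok W m2 ∧ HasStack (expandPush.den m2) (k ++ l) ∧ k.length ≤ 2 := by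
    have d1 : (isPath 20).Holds m2 ↔ 2 ≤ τ s := by simp [isPath, Test.Holds, NatExp.eval, e20, f6]
    have d2 : (isPath 21).Holds m2 ↔ 2 ≤ τ t := by simp [isPath, Test.Holds, NatExp.eval, e21, f6]
    have d3 : (isChild 21).Holds m2 ↔ 1 ≤ τ t := by
      simp [isChild, Test.Holds, NatExp.eval, e21, f6]
    have hpush : ∀ {m3 : Mem} {l : List Item} {x y t p q : ℕ}, HasStack m3 l → l.length + 1 ≤ W →
        t ≤ W → p ∉ [7, 8, 9, 15] → q ∉ [7, 8, 9, 15] → m3.nat p 0 = x → m3.nat q 0 = y →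
        x < 3 * n → y < 3 * n →
        (push t p q).Ok W m3 ∧ HasStack ((push t p q).den m3) (⟨t, x, y⟩ :: l) := by
      rintro m3 l x y t p q h1 h2 h3 h4 h5 rfl rfl h6 h7
      exact ⟨ok_push h1 h4 h5 h2 h3 (by omega) (by omega), h1.push h4 h5⟩
    have hP : ∀ {m3 : Mem} {l : List Item}, HasStack m3 l → l.length + 1 ≤ W →
        (∀ a, a ∉ [7, 8, 9, 15] → m3.nat a = m2.nat a) → (push 1 26 27).Ok W m3 ∧
        HasStack ((push 1 26 27).den m3)
          (⟨1, if 2 ≤ τ s then u else a, if 2 ≤ τ t then u else b⟩ :: l) := by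
      intro m3 l h1 h2 h3
      refine hpush h1 h2 (by omega) (by decide) (by decide) (by rw [h3 _ (by decide), e26])
        (by rw [h3 _ (by decide), e27]) ?_ ?_ <;> split_ifs <;> assumption
    have hB := hpush (t := 0) hl2 (by omega) (by omega) (by decide) (by decide) e25 e24 b25 b24
    have hB' := hpush (t := 0) hl2 (by omega) (by omega) (by decide) (by decide) e24 e25 b24 b25
    simp only [expandPush, Ok, den, Test.Holds, d1, d2, d3]
    by_cases c1 : 2 ≤ τ s ∧ 2 ≤ τ t
    · rw [if_pos c1] at hk
      obtain ⟨p1, p2⟩ := hpush (t := 1) hl2 (by omega) (by omega) (by decide) (by decide) f17 f16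
        hb ha
      obtain ⟨p3, p4⟩ := hpush (p := 25) (q := 24) (t := 0) p2 (by simp; omega) (by omega)
        (by decide) (by decide) (by rw [nat_push _ (by decide), e25])
        (by rw [nat_push _ (by decide), e24]) b25 b24
      simp only [if_pos c1, hk]
      exact ⟨⟨fun _ => ⟨p1, p3⟩, fun h => absurd c1 h⟩, p4, by simp⟩
    · rw [if_neg c1] at hk
      simp only [if_neg c1, hk]
      by_cases c2 : 2 ≤ τ t
      · obtain ⟨p3, p4⟩ := hP hB.2 (by simp; omega) (fun _ ha => nat_push _ ha)
        simp only [if_pos c2] at p3 p4 ⊢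
        exact ⟨⟨fun h => absurd h c1, fun _ => ⟨⟨fun _ => hB.1, fun h => absurd c2 h⟩, p3⟩⟩, p4,
          by simp⟩
      · by_cases c3 : 1 ≤ τ t
        · obtain ⟨p3, p4⟩ := hP hB'.2 (by simp; omega) (fun _ ha => nat_push _ ha)
          simp only [if_pos c3, if_neg c2] at p3 p4 ⊢
          exact ⟨⟨fun h => absurd h c1, fun _ => ⟨⟨fun h => absurd h c2, fun _ => ⟨fun _ => hB'.1,
            fun h => absurd c3 h⟩⟩, p3⟩⟩, p4, by simp⟩
        · obtain ⟨p3, p4⟩ := hP hl2 (by omega) (fun _ _ => rfl)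
          simp only [if_neg c3, if_neg c2] at p3 p4 ⊢
          exact ⟨⟨fun h => absurd h c1, fun _ => ⟨⟨fun h => absurd h c2, fun _ => ⟨fun h =>
            absurd h c3, fun _ => trivial⟩⟩, p3⟩⟩, p4, by simp⟩
  obtain ⟨hok3, hl3, hk2⟩ := hsplit
  have fr : ∀ a, a ∉ [7, 8, 9, 15] → (expandPush.den m2).nat a = m2.nat a := by
    intro a ha
    refine nat_den m2 fun h => ha ?_
    clear * - h
    revert a
    decide
  rw [← fr 20 (by decide)] at e20
  rw [← fr 22 (by decide)] at e22
  rw [← fr 23 (by decide)] at e23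
  rw [← fr 6 (by decide)] at f6
  generalize expandPush.den m2 = m3 at *
  have d1 : (isChild 20).Holds m3 ↔ 1 ≤ τ s := by simp [isChild, Test.Holds, NatExp.eval, e20, f6]
  simp only [d1]
  by_cases c1 : 1 ≤ τ s
  · simp only [if_pos c1]
    refine ⟨⟨hok, hok2, hok3, fun _ => ok_push hl3 (by decide) (by decide) ?_ (by omega)
      (by omega) (by omega), fun h => absurd c1 h⟩, ?_⟩
    · simp; omega
    · have := hl3.push (t := 0) (p := 22) (q := 23) (by decide) (by decide)
      rw [e22, e23] at this
      simpa using this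
  · simp only [if_neg c1]
    exact ⟨⟨hok, hok2, hok3, fun h => absurd h c1, fun _ => trivial⟩, by simpa using hl3⟩

end

/-! ### Placing the triangles in vertical strips -/

section

variable {X : Type*}

/-- Two placed triangles are joined at a common vertex. -/
def JoinedAt (V : ℕ → X) (x y : ℕ → ℝ) (E : Set ℕ) (t t' : ℕ) : Prop :=
  t ∈ E ∧ t' ∈ E ∧ ∃ k k', k / 3 = t ∧ k' / 3 = t' ∧ V k = V k' ∧ x k = x k' ∧ y k = y k'

/-- The triangles in `E` have been placed, with their corners at `(x k, y k)`, to the left of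
`(cx, cy)`, which is the position of the vertex `c`. -/
structure Placed (len : ℕ → ℝ) (V : ℕ → X) (x y : ℕ → ℝ) (E : Set ℕ) (cx cy : ℝ) (c : X) :
    Prop where
  dist : ∀ k, k / 3 ∈ E → (x k - x (nx k)) ^ 2 + (y k - y (nx k)) ^ 2 = len k ^ 2
  ccw : ∀ k, k / 3 ∈ E →
    0 < (x (nx k) - x k) * (y (nx (nx k)) - y k) - (y (nx k) - y k) * (x (nx (nx k)) - x k)
  left : ∀ k, k / 3 ∈ E → x k ≤ cx
  strip : ∀ t ∈ E, ∀ t' ∈ E, t ≠ t' →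
    (∃ z, ∀ k, (k / 3 = t → x k ≤ z) ∧ (k / 3 = t' → z ≤ x k)) ∨
      ∃ z, ∀ k, (k / 3 = t' → x k ≤ z) ∧ (k / 3 = t → z ≤ x k)
  joined : ∀ t ∈ E, ∀ t' ∈ E, Relation.ReflTransGen (JoinedAt V x y E) t t'
  current : E = ∅ ∨ ∃ k, k / 3 ∈ E ∧ V k = c ∧ x k = cx ∧ y k = cy

theorem placed_empty (len : ℕ → ℝ) (V : ℕ → X) (x y : ℕ → ℝ) (cx cy : ℝ) (c : X) :
    Placed len V x y ∅ cx cy c :=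
  ⟨by simp, by simp, by simp, by simp, by simp, Or.inl rfl⟩

theorem JoinedAt.symm {V : ℕ → X} {x y : ℕ → ℝ} {E : Set ℕ} {t t' : ℕ}
    (h : JoinedAt V x y E t t') : JoinedAt V x y E t' t :=
  let ⟨h1, h2, k, k', h3, h4, h5, h6, h7⟩ := h
  ⟨h2, h1, k', k, h4, h3, h5.symm, h6.symm, h7.symm⟩

/-- All earlier triangles lie to the left of the vertical line at `cx`, and the new one lies between
this line and the one through its exit corner `b`. It is joined to an earlier triangle with a corner
at the current vertex, and `b` becomes the current vertex. -/
theorem Placed.insert {len : ℕ → ℝ} {V : ℕ → X} {x y x' y' : ℕ → ℝ} {E : Set ℕ} {cx cy : ℝ} {c : X}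
    (h : Placed len V x y E cx cy c) {a b : ℕ} (hab : Adj a b) (ha : a / 3 ∉ E) (hc : V a = c)
    (hold : ∀ k, k / 3 ≠ a / 3 → x' k = x k ∧ y' k = y k) (hax : x' a = cx) (hay : y' a = cy)
    (hdist : ∀ k, k / 3 = a / 3 → (x' k - x' (nx k)) ^ 2 + (y' k - y' (nx k)) ^ 2 = len k ^ 2)
    (hccw : ∀ k, k / 3 = a / 3 → 0 < (x' (nx k) - x' k) * (y' (nx (nx k)) - y' k) -
      (y' (nx k) - y' k) * (x' (nx (nx k)) - x' k))
    (hleft : ∀ k, k / 3 = a / 3 → cx ≤ x' k ∧ x' k ≤ x' b) :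
    Placed len V x' y' (insert (a / 3) E) (x' b) (y' b) (V b) := by
  have hE : ∀ k, k / 3 ∈ E → x' k = x k ∧ y' k = y k := fun k hk =>
    hold k fun h' => ha (h' ▸ hk)
  have hxx' : cx ≤ x' b := (hleft b hab.div_eq.symm).1
  have hmono : ∀ t t', JoinedAt V x y E t t' → JoinedAt V x' y' (Insert.insert (a / 3) E) t t' := by
    rintro t t' ⟨h1, h2, k, k', rfl, rfl, h5, h6, h7⟩
    refine ⟨Or.inr h1, Or.inr h2, k, k', rfl, rfl, h5, ?_, ?_⟩
    · rw [(hE k h1).1, (hE k' h2).1, h6]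
    · rw [(hE k h1).2, (hE k' h2).2, h7]
  have hnew : ∀ t ∈ E, Relation.ReflTransGen (JoinedAt V x' y' (Insert.insert (a / 3) E)) t (a / 3) ∧
      Relation.ReflTransGen (JoinedAt V x' y' (Insert.insert (a / 3) E)) (a / 3) t := by
    intro t ht
    rcases h.current with h1 | ⟨k, h1, h2, h3, h4⟩
    · rw [h1] at ht
      exact ht.elim
    · have hj : JoinedAt V x' y' (Insert.insert (a / 3) E) (k / 3) (a / 3) := by
        refine ⟨Or.inr h1, Or.inl rfl, k, a, rfl, rfl, h2.trans hc.symm, ?_, ?_⟩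
        · rw [(hE k h1).1, h3, hax]
        · rw [(hE k h1).2, h4, hay]
      exact ⟨(Relation.ReflTransGen.mono hmono _ _ (h.joined t ht _ h1)).tail hj,
        (Relation.ReflTransGen.mono hmono _ _ (h.joined _ h1 t ht)).head hj.symm⟩
  constructor
  · rintro k (hk | hk)
    · exact hdist k hk
    · have h1 := hE k hk
      have h2 := hE (nx k) (by rwa [nx_div])
      rw [h1.1, h1.2, h2.1, h2.2]
      exact h.dist k hk
  · rintro k (hk | hk)
    · exact hccw k hk
    · have h1 := hE k hk
      have h2 := hE (nx k) (by rwa [nx_div])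
      have h3 := hE (nx (nx k)) (by rwa [nx_div, nx_div])
      rw [h1.1, h1.2, h2.1, h2.2, h3.1, h3.2]
      exact h.ccw k hk
  · rintro k (hk | hk)
    · exact (hleft k hk).2
    · rw [(hE k hk).1]
      exact (h.left k hk).trans hxx'
  · have key : ∀ t ∈ E, ∃ z, ∀ k, (k / 3 = t → x' k ≤ z) ∧ (k / 3 = a / 3 → z ≤ x' k) := by
      refine fun t ht => ⟨cx, fun k => ⟨?_, fun hk => (hleft k hk).1⟩⟩
      rintro rfl
      rw [(hE k ht).1]
      exact h.left k ht
    rintro t (rfl | ht) t' (rfl | ht') htt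
    · exact absurd rfl htt
    · exact Or.inr (key t' ht')
    · exact Or.inl (key t ht)
    · have conv : ∀ t ∈ E, ∀ t' ∈ E, (∃ z, ∀ k, (k / 3 = t → x k ≤ z) ∧ (k / 3 = t' → z ≤ x k)) →
          ∃ z, ∀ k, (k / 3 = t → x' k ≤ z) ∧ (k / 3 = t' → z ≤ x' k) := by
        rintro t ht t' ht' ⟨z, hz⟩
        refine ⟨z, fun k => ⟨?_, ?_⟩⟩
        · rintro rfl
          rw [(hE k ht).1]
          exact (hz k).1 rfl
        · rintro rfl
          rw [(hE k ht').1]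
          exact (hz k).2 rfl
      exact (h.strip t ht t' ht' htt).imp (conv t ht t' ht') (conv t' ht' t ht)
  · rintro t (rfl | ht) t' (rfl | ht')
    · exact .refl
    · exact (hnew t' ht').2
    · exact (hnew t ht).1
    · exact Relation.ReflTransGen.mono hmono _ _ (h.joined t ht t' ht')
  · exact Or.inr ⟨b, Or.inl hab.div_eq.symm, rfl, rfl, rfl⟩

/-- The slopes of the two shorter sides when the exterior bisector of the angle between the sides
`A` and `B` is horizontal. -/
theorem slopes_spec {c A B : ℝ} (h1 : c < A + B) (h2 : A < B + c) (h3 : B < A + c) {K H : ℝ}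
    (hK : K = √((c * c - (A - B) * (A - B)) / (4 * (A * B))))
    (hH : H = √(((A + B) * (A + B) - c * c) / (4 * (A * B)))) :
    0 < A ∧ 0 < B ∧ 0 < K ∧ 0 < H ∧ K ^ 2 + H ^ 2 = 1 ∧
      ((A + B) * K) ^ 2 + ((B - A) * H) ^ 2 = c ^ 2 := by
  have hA : 0 < A := by linarith
  have hB : 0 < B := by linarith
  have hc : 0 < c := by linarith
  -- If `γ` is the angle between the sides `A` and `B`, the law of cosines turns the two radicands
  -- into `sin² (γ/2)` and `cos² (γ/2)`. The strict triangle inequalities make both positive.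
  have p1 : 0 < (c * c - (A - B) * (A - B)) / (4 * (A * B)) := by
    have : c * c - (A - B) * (A - B) = (c - (A - B)) * (c + (A - B)) := by ring
    rw [this]
    have := mul_pos (a := c - (A - B)) (b := c + (A - B)) (by linarith) (by linarith)
    positivity
  have p2 : 0 < ((A + B) * (A + B) - c * c) / (4 * (A * B)) := by
    have : (A + B) * (A + B) - c * c = ((A + B) - c) * ((A + B) + c) := by ring
    rw [this]
    have := mul_pos (a := A + B - c) (b := A + B + c) (by linarith) (by linarith)
    positivity
  have e1 : K ^ 2 = (c * c - (A - B) * (A - B)) / (4 * (A * B)) := by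
    rw [hK, Real.sq_sqrt p1.le]
  have e2 : H ^ 2 = ((A + B) * (A + B) - c * c) / (4 * (A * B)) := by
    rw [hH, Real.sq_sqrt p2.le]
  refine ⟨hA, hB, hK ▸ Real.sqrt_pos.2 p1, hH ▸ Real.sqrt_pos.2 p2, ?_, ?_⟩
  · rw [e1, e2]
    field_simp
    ring
  · rw [mul_pow, mul_pow, e1, e2]
    field_simp
    ring

/-- Computes the third corner, the side lengths and the orientation of the triangle with the
corners in the variables 16 and 17. -/
def placeSetup : Program :=
  .ite isNext
    (.assign 19 (.load 3 (.var 17)) ⨟ .assignReal 5 (.load 0 (.var 16)) ⨟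
     .assignReal 6 (.load 0 (.var 17)) ⨟ .assignReal 7 (.load 0 (.var 19)) ⨟
     .assignReal 9 (.const 1))
    (.assign 19 (.load 3 (.var 16)) ⨟ .assignReal 5 (.load 0 (.var 17)) ⨟
     .assignReal 6 (.load 0 (.var 19)) ⨟ .assignReal 7 (.load 0 (.var 16)) ⨟
     .assignReal 9 (.sub (.const 0) (.const 1)))

/-- Computes the slopes of the sides. -/
def placeSlopes : Program :=
  .assignReal 8 (.sqrt (.div
    (.sub (.mul (.var 5) (.var 5)) (.mul (.sub (.var 6) (.var 7)) (.sub (.var 6) (.var 7))))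
    (.mul (.const 4) (.mul (.var 6) (.var 7))))) ⨟
  .assignReal 9 (.mul (.var 9) (.sqrt (.div
    (.sub (.mul (.add (.var 6) (.var 7)) (.add (.var 6) (.var 7))) (.mul (.var 5) (.var 5)))
    (.mul (.const 4) (.mul (.var 6) (.var 7))))))

/-- Writes the coordinates of the corners. -/
def placeCorners : Program :=
  .setReal 1 (.var 16) (.var 3) ⨟ .setReal 2 (.var 16) (.var 4) ⨟
  .setReal 1 (.var 19) (.add (.var 3) (.mul (.var 7) (.var 8))) ⨟
  .setReal 2 (.var 19) (.add (.var 4) (.mul (.var 7) (.var 9))) ⨟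
  .assignReal 3 (.add (.var 3) (.mul (.add (.var 6) (.var 7)) (.var 8))) ⨟
  .assignReal 4 (.add (.var 4) (.mul (.sub (.var 7) (.var 6)) (.var 9))) ⨟
  .setReal 1 (.var 17) (.var 3) ⨟ .setReal 2 (.var 17) (.var 4)

/-- Places the triangle with the corners in the variables 16 and 17. -/
def placeItem : Program := placeSetup ⨟ placeSlopes ⨟ placeCorners

/-- The abscissae of `a`, `u`, `b` are `cx`, `cx + lB * K`, `cx + (lA + lB) * K`, increasing since
`K > 0`. The sign `σ` puts `u` above the line `ab` if `b` follows `a` in the triangle and below it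
otherwise, which makes the corners counterclockwise in both cases. -/
theorem placeItem_spec {W n : ℕ} {opp : ℕ → ℕ} {m : Mem} (hW : 3 * n ≤ W) (h : HasTables n opp m)
    {len : ℕ → ℝ} (hlen : ∀ k < 3 * n, m.real 0 k = len k)
    (htri : ∀ k < 3 * n, len k < len (nx k) + len (nx (nx k)))
    {V : ℕ → X} {E : Set ℕ} {c : X} {a b : ℕ} (ha : a < 3 * n) (hb : b < 3 * n)
    (hab : Adj a b) (ha' : m.nat 16 0 = a) (hb' : m.nat 17 0 = b) (haE : a / 3 ∉ E) (hc : V a = c)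
    (hP : Placed len V (m.real 1) (m.real 2) E (m.real 3 0) (m.real 4 0) c) :
    placeItem.Ok W m ∧ Placed len V ((placeItem.den m).real 1) ((placeItem.den m).real 2)
      (insert (a / 3) E) ((placeItem.den m).real 3 0) ((placeItem.den m).real 4 0) (V b) := by
  have na := h.next a ha
  have nb := h.next b hb
  have la := nx_lt ha
  have lb := nx_lt hb
  have htest : isNext.Holds m ↔ nx a = b := by
    simp only [isNext, Test.Holds, NatExp.eval, ha', hb', na]
    omega
  obtain ⟨u, hu⟩ : ∃ u, u = third a b := ⟨_, rfl⟩
  obtain ⟨σ, hσ⟩ : ∃ σ : ℝ, σ = if nx a = b then 1 else -1 := ⟨_, rfl⟩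
  obtain ⟨lc, hlc⟩ : ∃ l, l = if nx a = b then len a else len b := ⟨_, rfl⟩
  obtain ⟨lA, hlA⟩ : ∃ l, l = if nx a = b then len b else len u := ⟨_, rfl⟩
  obtain ⟨lB, hlB⟩ : ∃ l, l = if nx a = b then len u else len a := ⟨_, rfl⟩
  have hau := adj_third_left hab
  have hbu := adj_third_right hab
  rw [← hu] at hau hbu
  have hun : u < 3 * n := by
    have := hau.div_eq
    omega
  have hok1 : placeSetup.Ok W m := by
    simp [placeSetup, Ok, den, NatExp.eval, ha', hb', na, nb]
    omega
  have s19 : (placeSetup.den m).nat 19 0 = u := by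
    rw [hu, third]
    simp only [placeSetup, den, htest]
    split_ifs <;> simp [NatExp.eval, ha', hb', na, nb]
  have s5 : (placeSetup.den m).real 5 0 = lc := by
    rw [hlc]
    simp only [placeSetup, den, htest]
    split_ifs <;> simp [NatExp.eval, RealExp.eval, ha', hb', hlen, ha, hb]
  have s6 : (placeSetup.den m).real 6 0 = lA := by
    rw [hlA, hu, third]
    simp only [placeSetup, den, htest]
    split_ifs <;> simp [NatExp.eval, RealExp.eval, ha', hb', na, nb, hlen, ha, hb, la, lb]
  have s7 : (placeSetup.den m).real 7 0 = lB := by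
    rw [hlB, hu, third]
    simp only [placeSetup, den, htest]
    split_ifs <;> simp [NatExp.eval, RealExp.eval, ha', hb', na, nb, hlen, ha, hb, la, lb]
  have s9 : (placeSetup.den m).real 9 0 = σ := by
    rw [hσ]
    simp only [placeSetup, den, htest]
    split_ifs <;> simp [NatExp.eval, RealExp.eval]
  have s16 : (placeSetup.den m).nat 16 0 = a := by rw [nat_den m (by decide), ha']
  have s17 : (placeSetup.den m).nat 17 0 = b := by rw [nat_den m (by decide), hb']
  have s1 : (placeSetup.den m).real 1 = m.real 1 := real_den m (by decide)
  have s2 : (placeSetup.den m).real 2 = m.real 2 := real_den m (by decide)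
  have s3 : (placeSetup.den m).real 3 = m.real 3 := real_den m (by decide)
  have s4 : (placeSetup.den m).real 4 = m.real 4 := real_den m (by decide)
  simp only [placeItem, Ok, den]
  generalize placeSetup.den m = m1 at *
  obtain ⟨K, hK⟩ : ∃ K, K = √((lc * lc - (lA - lB) * (lA - lB)) / (4 * (lA * lB))) := ⟨_, rfl⟩
  obtain ⟨H, hH⟩ : ∃ H, H = √(((lA + lB) * (lA + lB) - lc * lc) / (4 * (lA * lB))) := ⟨_, rfl⟩
  have hok2 : placeSlopes.Ok W m1 := by
    simp [placeSlopes, Ok, den, NatExp.eval]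
  have t8 : (placeSlopes.den m1).real 8 0 = K := by
    simp [placeSlopes, den, NatExp.eval, RealExp.eval, s5, s6, s7, hK]
  have t9 : (placeSlopes.den m1).real 9 0 = σ * H := by
    simp [placeSlopes, den, NatExp.eval, RealExp.eval, s5, s6, s7, s9, hH]
  have fr : ∀ i, i ∉ [8, 9] → (placeSlopes.den m1).real i = m1.real i := fun i hi => real_den m1 hi
  have fn : ∀ i, (placeSlopes.den m1).nat i = m1.nat i := fun i =>
    nat_den m1 (by simp [placeSlopes, natWrites])
  rw [← fn] at s16 s17 s19
  rw [← fr _ (by decide)] at s1 s2 s3 s4 s6 s7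
  generalize placeSlopes.den m1 = m2 at *
  have hab' : a ≠ b := by rcases hab with rfl | rfl; exacts [(nx_ne _).symm, nx_ne _]
  have hau' : a ≠ u := by rcases hau with rfl | rfl; exacts [(nx_ne _).symm, nx_ne _]
  have hbu' : b ≠ u := by rcases hbu with rfl | rfl; exacts [(nx_ne _).symm, nx_ne _]
  set cx := m.real 3 0 with hcx
  set cy := m.real 4 0 with hcy
  have hok3 : placeCorners.Ok W m2 := by
    simp [placeCorners, Ok, den, NatExp.eval, s16, s17, s19]
    omega
  have ex : ∀ k, (placeCorners.den m2).real 1 k = if k = b then cx + (lA + lB) * K else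
      if k = u then cx + lB * K else if k = a then cx else m.real 1 k := by
    intro k
    simp [placeCorners, den, NatExp.eval, RealExp.eval, s16, s17, s19, s1, s3, s6, s7, t8, ← hcx]
  have ey : ∀ k, (placeCorners.den m2).real 2 k = if k = b then cy + (lB - lA) * (σ * H) else
      if k = u then cy + lB * (σ * H) else if k = a then cy else m.real 2 k := by
    intro k
    simp [placeCorners, den, NatExp.eval, RealExp.eval, s16, s17, s19, s2, s4, s6, s7, t9, ← hcy]
  have ecx : (placeCorners.den m2).real 3 0 = (placeCorners.den m2).real 1 b := by
    simp [placeCorners, den, NatExp.eval, RealExp.eval, s17]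
  have ecy : (placeCorners.den m2).real 4 0 = (placeCorners.den m2).real 2 b := by
    simp [placeCorners, den, NatExp.eval, RealExp.eval, s17]
  refine ⟨⟨hok1, hok2, hok3⟩, ?_⟩
  rw [ecx, ecy]
  generalize (placeCorners.den m2).real 1 = x' at *
  generalize (placeCorners.den m2).real 2 = y' at *
  have xa : x' a = cx := by rw [ex, if_neg hab', if_neg hau', if_pos rfl]
  have ya : y' a = cy := by rw [ey, if_neg hab', if_neg hau', if_pos rfl]
  have xu : x' u = cx + lB * K := by rw [ex, if_neg hbu'.symm, if_pos rfl]
  have yu : y' u = cy + lB * (σ * H) := by rw [ey, if_neg hbu'.symm, if_pos rfl]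
  have xb : x' b = cx + (lA + lB) * K := by rw [ex, if_pos rfl]
  have yb : y' b = cy + (lB - lA) * (σ * H) := by rw [ey, if_pos rfl]
  have hcyc : (nx a = b ∧ nx b = u ∧ nx u = a) ∨ (nx a ≠ b ∧ nx b = a ∧ nx a = u ∧ nx u = b) := by
    by_cases hc : nx a = b
    · left
      rw [hu, third, if_pos hc]
      exact ⟨hc, rfl, by rw [← hc, nx_nx_nx]⟩
    · right
      have hc' : nx b = a := hab.resolve_left hc
      rw [hu, third, if_neg hc]
      exact ⟨hc, hc', rfl, by rw [← hc', nx_nx_nx]⟩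
  have hσ2 : σ ^ 2 = 1 := by rw [hσ]; split_ifs <;> norm_num
  have ta := htri a ha
  have tb := htri b hb
  have tu := htri u hun
  have hineq : lc < lA + lB ∧ lA < lB + lc ∧ lB < lA + lc := by
    rcases hcyc with ⟨c1, c2, c3⟩ | ⟨c0, c1, c2, c3⟩
    · simp only [hlA, hlB, hlc, if_pos c1]
      rw [c1, c2] at ta
      rw [c2, c3] at tb
      rw [c3, c1] at tu
      exact ⟨ta, tb, by linarith⟩
    · simp only [hlA, hlB, hlc, if_neg c0]
      rw [c2, c3] at ta
      rw [c3, c1] at tu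
      rw [c1, c2] at tb
      exact ⟨by linarith, by linarith, by linarith⟩
  obtain ⟨pA, pB, pK, pH, i1, i2⟩ := slopes_spec hineq.1 hineq.2.1 hineq.2.2 hK hH
  have hAK := mul_pos pA pK
  have hBK := mul_pos pB pK
  -- This is the determinant in `ccw`, twice the area of the triangle.
  have hABKH : 0 < 2 * (lA * K) * (lB * H) := by positivity
  have hthree : ∀ k, k / 3 = a / 3 → k = a ∨ k = b ∨ k = u := by
    intro k hk
    rw [div_eq_iff_nx] at hk
    rcases hcyc with ⟨c1, c2, c3⟩ | ⟨c0, c1, c2, c3⟩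
    · rwa [c1, c2] at hk
    · rw [c2, c3] at hk
      tauto
  refine hP.insert hab haE hc ?_ xa ya ?_ ?_ ?_
  · intro k hk
    have k1 : k ≠ a := by rintro rfl; exact hk rfl
    have k2 : k ≠ b := by rintro rfl; exact hk hab.div_eq.symm
    have k3 : k ≠ u := by rintro rfl; exact hk hau.div_eq.symm
    rw [ex, ey]
    simp [k1, k2, k3]
  · have d1 : ((lA + lB) * K) ^ 2 + ((lB - lA) * (σ * H)) ^ 2 = lc ^ 2 := by
      rw [← i2]; linear_combination ((lB - lA) * H) ^ 2 * hσ2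
    have d2 : (lB * K) ^ 2 + (lB * (σ * H)) ^ 2 = lB ^ 2 := by
      linear_combination (lB * H) ^ 2 * hσ2 + lB ^ 2 * i1
    have d3 : (lA * K) ^ 2 + (lA * (σ * H)) ^ 2 = lA ^ 2 := by
      linear_combination (lA * H) ^ 2 * hσ2 + lA ^ 2 * i1
    intro k hk
    rcases hcyc with ⟨c1, c2, c3⟩ | ⟨c0, c1, c2, c3⟩
    · rw [if_pos c1] at hlA hlB hlc
      rcases hthree k hk with rfl | rfl | rfl
      · rw [c1, xa, ya, xb, yb, ← hlc, ← d1]; ring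
      · rw [c2, xu, yu, xb, yb, ← hlA, ← d3]; ring
      · rw [c3, xa, ya, xu, yu, ← hlB, ← d2]; ring
    · rw [if_neg c0] at hlA hlB hlc
      rcases hthree k hk with rfl | rfl | rfl
      · rw [c2, xa, ya, xu, yu, ← hlB, ← d2]; ring
      · rw [c1, xa, ya, xb, yb, ← hlc, ← d1]; ring
      · rw [c3, xu, yu, xb, yb, ← hlA, ← d3]; ring
  · intro k hk
    rcases hcyc with ⟨c1, c2, c3⟩ | ⟨c0, c1, c2, c3⟩
    · rw [if_pos c1] at hσ
      rcases hthree k hk with rfl | rfl | rfl <;>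
        simp only [c1, c2, c3, xa, ya, xb, yb, xu, yu, hσ] <;> refine hABKH.trans_eq ?_ <;> ring
    · rw [if_neg c0] at hσ
      rcases hthree k hk with rfl | rfl | rfl <;>
        simp only [c1, c2, c3, xa, ya, xb, yb, xu, yu, hσ] <;> refine hABKH.trans_eq ?_ <;> ring
  · intro k hk
    rcases hthree k hk with rfl | rfl | rfl
    · rw [xa, xb]; exact ⟨le_rfl, by linarith⟩
    · rw [xb]; exact ⟨by linarith, le_rfl⟩
    · rw [xu, xb]; exact ⟨by linarith, by linarith⟩

end

/-! ### The program: the layout -/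

section

variable {X : Type*} {n : ℕ} {opp : ℕ → ℕ} {V : ℕ → X}

/-- A variant of `runs_while` where the bound for the number of rounds is part of the invariant. -/
theorem runs_while_of_bound {W N k : ℕ} {b : Test} {p : Program} {m₀ : Mem} (I : ℕ → Mem → Prop)
    (h₀ : I k m₀) (hk : k ≤ N)
    (hI : ∀ k m, I k m → (∀ a, a ∉ p.natWrites → m.nat a = m₀.nat a) →
      (∀ a, a ∉ p.realWrites → m.real a = m₀.real a) → b.Holds m →
      p.Ok W m ∧ ∃ k' < k, I k' (p.den m)) :
    Runs W N (.while b p) m₀ (fun m' => (∃ k, I k m') ∧ ¬ b.Holds m' ∧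
      (∀ a, a ∉ p.natWrites → m'.nat a = m₀.nat a) ∧
      ∀ a, a ∉ p.realWrites → m'.real a = m₀.real a) := by
  -- The least admissible `k` serves as the bound on the remaining rounds.
  refine runs_while (fun m => ∃ k, I k m) (fun m => sInf {k | I k m}) ⟨k, h₀⟩
    ((Nat.sInf_le (s := {k | I k m₀}) h₀).trans hk) fun m hm f g hb => ?_
  obtain ⟨h1, k', hk', h2⟩ := hI _ m (Nat.sInf_mem (s := {k | I k m}) hm) f g hb
  exact ⟨h1, ⟨k', h2⟩, (Nat.sInf_le (s := {k | I k (p.den m)}) h2).trans_lt hk'⟩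

/-- The placed triangles and those of the items are all different. This keeps the stack within the
word size and bounds the number of rounds. -/
theorem Pending.ncard_add_length_le {q τ : ℕ → ℕ} {E : Set ℕ} {l : List Item} {c : X}
    (h : Pending n opp q τ V E l c) : E.ncard + l.length ≤ n := by
  have hfin : E.Finite := (Set.finite_lt_nat n).subset h.sub
  have hnd : (l.map fun x => x.a / 3).Nodup := by
    rw [List.Nodup, List.pairwise_map]
    exact h.pairwise
  have hcard : ((l.map fun x => x.a / 3).toFinset).card = l.length := by
    rw [List.toFinset_card_of_nodup hnd, List.length_map]
  rw [← hcard, ← Set.ncard_coe_finset, ← Set.ncard_union_eq ?_ hfin (Finset.finite_toSet _)]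
  · calc _ ≤ (Set.Iio n).ncard := by
          refine Set.ncard_le_ncard ?_ (Set.finite_Iio n)
          rintro t (ht | ht)
          · exact h.sub t ht
          · simp only [List.coe_toFinset, List.mem_map, Set.mem_ofPred_eq] at ht
            obtain ⟨x, hx, rfl⟩ := ht
            have := (h.lt x hx).1
            simp only [Set.mem_Iio]
            omega
      _ = n := by
          rw [← Finset.coe_Iio, Set.ncard_coe_finset, Nat.card_Iio]
  · rw [Set.disjoint_right]
    intro t ht
    simp only [List.coe_toFinset, List.mem_map, Set.mem_ofPred_eq] at ht
    obtain ⟨x, hx, rfl⟩ := ht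
    exact h.notMem x hx

/-- Needed to count rounds: each expansion adds one item of tag 1, for the top triangle. -/
theorem countP_expansion (m₀ m₁ τ : ℕ → ℕ) (x : Item) :
    (expansion m₀ m₁ τ x).countP (fun y => y.tag = 1) = 1 := by
  unfold expansion
  simp only [List.countP_append]
  split_ifs <;> simp [List.countP_cons]

/-- Initializes the stack. -/
def initStack : Program :=
  .assign 16 (.const 0) ⨟ .assign 17 (.const 1) ⨟
  .assign 24 (.load 13 (.const 0)) ⨟ .assign 25 (.load 14 (.const 0)) ⨟
  .ite (.natLe (.const 1) (.load 6 (.const 0)))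
    (.ite (.and (.natLe (.const 2) (.load 6 (.const 1))) (.natLe (.const 2) (.load 6 (.const 2))))
      (push 0 24 25) (push 0 25 24))
    .skip ⨟
  push 0 16 17

theorem initStack_spec {W : ℕ} {m : Mem} (hn : 0 < n) (hW : 3 * n ≤ W)
    (hg : IsGluing n opp (m.nat 13) (m.nat 14) V) (h15 : m.nat 15 0 = 0) :
    initStack.Ok W m ∧ HasStack (initStack.den m) (start (m.nat 13) (m.nat 14) (m.nat 6)) := by
  have l0 := hg.lt₀ (s := 0) (by omega)
  have l1 := hg.lt₁ (s := 0) (by omega)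
  constructor
  · simp [initStack, push, Ok, den, NatExp.eval, Test.Holds, h15]
    split_ifs <;> simp [h15] <;> omega
  · unfold start
    split_ifs with h1 h2 <;>
      simp [initStack, push, den, NatExp.eval, Test.Holds, h15, h1, HasStack, IsStack]
    · simp [h2, h15]
    · simp [h2, h15]

/-- Removes an item from the stack. -/
def popItem : Program :=
  .assign 15 (.sub (.var 15) (.const 1)) ⨟
  .assign 16 (.load 8 (.var 15)) ⨟
  .assign 17 (.load 9 (.var 15))

/-- Processes the items on the stack. -/
def layoutLoop : Program :=
  .while (.natLe (.const 1) (.var 15))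
    (popItem ⨟ .ite (.natLe (.const 1) (.load 7 (.var 15))) placeItem expandItem)

theorem popItem_spec {W : ℕ} {m : Mem} {x : Item} {l : List Item} (h : HasStack m (x :: l))
    (hl : l.length ≤ W) (ha : x.a ≤ W) (hb : x.b ≤ W) :
    popItem.Ok W m ∧ HasStack (popItem.den m) l ∧ (popItem.den m).nat 16 0 = x.a ∧
      (popItem.den m).nat 17 0 = x.b ∧ (popItem.den m).nat 7 ((popItem.den m).nat 15 0) = x.tag := by
  obtain ⟨h15, h7, h8, h9, hs⟩ := h
  simp only [List.length_cons] at h15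
  simp [popItem, Ok, den, NatExp.eval, h15, h7, h8, h9, HasStack, hl, ha, hb]
  exact hs

/-- Twice the number of placed triangles plus the number of items of tag 1 grows by one in every
round: an expansion creates one such item, and a placement trades one for a placed triangle. It
never exceeds `2 * n`. -/
theorem runs_layout {W N : ℕ} {m : Mem} (hn : 0 < n) (hW : 3 * n ≤ W) (hN : 2 * n ≤ N)
    (h : HasTables n opp m) (hg : IsGluing n opp (m.nat 13) (m.nat 14) V)
    (hq : IsDualTree n opp (m.nat 5) n) (hτ : IsTyping n opp (m.nat 5) (m.nat 6))
    (h15 : m.nat 15 0 = 0) {len : ℕ → ℝ} (hlen : ∀ k < 3 * n, m.real 0 k = len k)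
    (htri : ∀ k < 3 * n, len k < len (nx k) + len (nx (nx k))) :
    Runs W N (initStack ⨟ layoutLoop) m (fun m' => ∃ E cx cy c, (∀ i < n, m.nat 5 i / 3 ∈ E) ∧
      Placed len V (m'.real 1) (m'.real 2) E cx cy c) := by
  obtain ⟨i1, i2⟩ := initStack_spec hn hW hg h15
  refine Runs.seq (i1.runs (Q := fun m' => m' = initStack.den m) rfl) ?_
  rintro m₁ rfl
  have fr : ∀ a, a ∉ [16, 17, 24, 25, 7, 8, 9, 15] → (initStack.den m).nat a = m.nat a := by
    refine fun a ha => nat_den m fun h => ha ?_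
    clear * - h
    revert a
    decide
  have fr' : ∀ a, (initStack.den m).real a = m.real a := fun a => real_den m (by
    simp [initStack, push, realWrites])
  generalize initStack.den m = m₁ at *
  refine (runs_while_of_bound (k := 2 * n) (fun k m' => ∃ E l c, HasStack m' l ∧
      Pending n opp (m.nat 5) (m.nat 6) V E l c ∧
      Placed len V (m'.real 1) (m'.real 2) E (m'.real 3 0) (m'.real 4 0) c ∧
      2 * E.ncard + l.countP (fun y => y.tag = 1) + k = 2 * n)
    ⟨∅, _, V 0, i2, pending_start hg hq hτ, placed_empty _ _ _ _ _ _ _, ?_⟩ hN ?_).mono ?_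
  · unfold start
    split_ifs <;> simp
  · rintro k m' ⟨E, l, c, hl, hP, hL, hk⟩ f g hb
    have f' : ∀ a, a ∈ [0, 1, 3, 5, 6, 13, 14] → m'.nat a = m.nat a := by
      intro a ha
      rw [f a (by revert a; decide), fr a (by clear * - ha; revert a; decide)]
    have g0 : m'.real 0 = m.real 0 := by rw [g 0 (by decide), fr']
    obtain _ | ⟨x, l⟩ := l
    · simp only [Test.Holds, NatExp.eval, hl.1] at hb
      simp at hb
    have hcard := hP.ncard_add_length_le
    obtain ⟨xa, xb⟩ := hP.lt x List.mem_cons_self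
    have hadj := hP.adj x List.mem_cons_self
    have hxE := hP.notMem x List.mem_cons_self
    simp only [List.length_cons] at hcard
    obtain ⟨p1, p2, p3, p4, p5⟩ := popItem_spec hl (W := W) (by omega) (by omega) (by omega)
    have pf : ∀ a, a ∉ [15, 16, 17] → (popItem.den m').nat a = m'.nat a := fun a ha => nat_den m' ha
    have pr : ∀ a, (popItem.den m').real a = m'.real a := fun a => real_den m' (by
      simp [popItem, realWrites])
    simp only [Ok, den, Test.Holds, NatExp.eval, p5]
    have ht2 : HasTables n opp (popItem.den m') := by
      refine ⟨?_, ?_, ?_⟩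
      · rw [pf 0 (by decide), f' 0 (by decide), h.size]
      · rw [pf 1 (by decide), f' 1 (by decide)]; exact h.mate
      · rw [pf 3 (by decide), f' 3 (by decide)]; exact h.next
    have e13 : (popItem.den m').nat 13 = m.nat 13 := by rw [pf 13 (by decide), f' 13 (by decide)]
    have e14 : (popItem.den m').nat 14 = m.nat 14 := by rw [pf 14 (by decide), f' 14 (by decide)]
    have e6 : (popItem.den m').nat 6 = m.nat 6 := by rw [pf 6 (by decide), f' 6 (by decide)]
    have hg2 : IsGluing n opp ((popItem.den m').nat 13) ((popItem.den m').nat 14) V := by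
      rwa [e13, e14]
    rw [← pr 1, ← pr 2, ← pr 3, ← pr 4] at hL
    have hlen2 : ∀ k < 3 * n, (popItem.den m').real 0 k = len k := by
      rw [pr, g0]; exact hlen
    generalize popItem.den m' = m2 at *
    have hfin : E.Finite := (Set.finite_lt_nat n).subset hP.sub
    rcases hP.tag x List.mem_cons_self with ⟨htag, -⟩ | htag
    · -- a subtree
      obtain ⟨q1, q2⟩ := expandItem_spec hW ht2 hg2 xa xb hadj p3 p4 p2 (by omega)
      have hx : x = ⟨0, x.a, x.b⟩ := by ext <;> simp [htag]
      rw [e13, e14, e6, ← hx] at q2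
      have hP' := hP.expand hg hq hτ htag
      have hcard' := hP'.ncard_add_length_le
      have r : ∀ a, (expandItem.den m2).real a = m2.real a := fun a => real_den m2 (by
        simp [expandItem, expandSetup, expandEnds, expandPush, push, realWrites])
      have h01 : ¬ (1 ≤ 0) := by omega
      simp only [htag, h01, if_false]
      refine ⟨⟨p1, fun h => h.elim, fun _ => q1⟩, k - 1, ?_, E, _, c, q2, hP', ?_, ?_⟩
      all_goals
        have hle := (expansion (m.nat 13) (m.nat 14) (m.nat 6) x ++ l).countP_le_length
          (p := fun y => y.tag = 1)
        rw [List.countP_append, countP_expansion] at *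
        rw [List.countP_cons, if_neg (by simp [htag])] at hk
      · omega
      · rw [r 1, r 2, r 3, r 4]; exact hL
      · omega
    · -- a triangle
      obtain ⟨q1, q2⟩ := placeItem_spec hW ht2 hlen2 htri xa xb hadj p3 p4 hxE hP.chain.1 hL
      have hP' := hP.place htag
      simp only [htag, le_refl, if_true]
      rw [List.countP_cons, if_pos (by simp [htag])] at hk
      have hnc := Set.ncard_insert_of_notMem hxE hfin
      have hle := l.countP_le_length (p := fun y => y.tag = 1)
      refine ⟨⟨p1, fun _ => q1, fun h => absurd trivial h⟩, k - 1, ?_, _, l, _, ?_, hP', q2, ?_⟩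
      · have := hP'.ncard_add_length_le
        rw [hnc] at this
        omega
      · exact p2.congr fun a ha => nat_den m2 (by revert a; decide)
      · have := hP'.ncard_add_length_le
        rw [hnc] at this ⊢
        omega
  · rintro m' ⟨⟨k, E, l, c, hl, hP, hL, hk⟩, hb, -⟩
    simp only [Test.Holds, NatExp.eval, hl.1] at hb
    obtain rfl : l = [] := List.eq_nil_of_length_eq_zero (by omega)
    exact ⟨E, _, _, c, hP.mem_of_nil hq, hL⟩

end

/-! ### The surface in terms of numbers -/

/-- The number of a side or corner. -/
def sideIndex {n : ℕ} (e : Fin n × Fin 3) : ℕ := 3 * e.1 + e.2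

theorem sideIndex_lt {n : ℕ} (e : Fin n × Fin 3) : sideIndex e < 3 * n := by
  unfold sideIndex
  omega

theorem sideIndex_div {n : ℕ} (e : Fin n × Fin 3) : sideIndex e / 3 = e.1 := by
  unfold sideIndex
  omega

theorem sideOfIndex_sideIndex {n : ℕ} (e : Fin n × Fin 3) :
    sideOfIndex (sideIndex e) (sideIndex_lt e) = e := by
  obtain ⟨t, s⟩ := e
  simp only [sideOfIndex, sideIndex, Prod.mk.injEq, Fin.ext_iff]
  omega

theorem sideIndex_sideOfIndex {n k : ℕ} (hk : k < 3 * n) : sideIndex (sideOfIndex k hk) = k := by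
  simp only [sideOfIndex, sideIndex]
  omega

theorem nx_sideIndex {n : ℕ} (t : Fin n) (s : Fin 3) : nx (sideIndex (t, s)) = sideIndex (t, s + 1) := by
  unfold nx sideIndex
  fin_cases s <;> simp

namespace TriangulatedSurface

variable {n : ℕ} (M : TriangulatedSurface n)

/-- The number of the side glued to side `k`. -/
def opp (k : ℕ) : ℕ := if hk : k < 3 * n then sideIndex (M.mate (sideOfIndex k hk)) else 0

/-- The vertex of the corner with number `k`. -/
def vert (k : ℕ) : Option M.Space :=
  if hk : k < 3 * n then some (M.vertex (sideOfIndex k hk).1 (sideOfIndex k hk).2) else none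

theorem opp_sideIndex (e : Fin n × Fin 3) : M.opp (sideIndex e) = sideIndex (M.mate e) := by
  rw [opp, dif_pos (sideIndex_lt e), sideOfIndex_sideIndex]

theorem vert_sideIndex (e : Fin n × Fin 3) : M.vert (sideIndex e) = some (M.vertex e.1 e.2) := by
  rw [vert, dif_pos (sideIndex_lt e), sideOfIndex_sideIndex]

theorem vertex_eq_vertex {t t' : Fin n} {s s' : Fin 3} (h : M.mate (t, s) = (t', s')) :
    if M.reversed (t, s) = true then
      M.vertex t s = M.vertex t' (s' + 1) ∧ M.vertex t (s + 1) = M.vertex t' s'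
    else M.vertex t s = M.vertex t' s' ∧ M.vertex t (s + 1) = M.vertex t' (s' + 1) := by
  have h1 : ∀ s : Fin 3, s ≠ s + 1 ∧ s ≠ s + 2 ∧ s + 1 ≠ s + 2 := by decide
  obtain ⟨a1, a2, a3⟩ := h1 s
  obtain ⟨b1, b2, b3⟩ := h1 s'
  split_ifs with hr
  · constructor <;> refine Quot.sound ⟨s, s', h, ?_⟩ <;>
      simp [hr, a1, a2, a3, b1, b2, b3, a1.symm, a2.symm, a3.symm, b1.symm, b2.symm, b3.symm]
  · constructor <;> refine Quot.sound ⟨s, s', h, ?_⟩ <;>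
      simp [hr, a1, a2, a3, b1, b2, b3, a1.symm, a2.symm, a3.symm, b1.symm, b2.symm, b3.symm]

theorem eq_sideIndex {k : ℕ} (hk : k < 3 * n) : ∃ t s, k = sideIndex ((t, s) : Fin n × Fin 3) :=
  ⟨_, _, (sideIndex_sideOfIndex hk).symm⟩

theorem isGluing {m₀ m₁ : ℕ → ℕ}
    (h₀ : ∀ e, m₀ (sideIndex e) = if M.reversed e = true then nx (M.opp (sideIndex e)) else
      M.opp (sideIndex e))
    (h₁ : ∀ e, m₁ (sideIndex e) = if M.reversed e = true then M.opp (sideIndex e) else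
      nx (M.opp (sideIndex e))) :
    IsGluing n M.opp m₀ m₁ M.vert := by
  constructor <;> intro k hk <;> obtain ⟨t, s, rfl⟩ := eq_sideIndex hk
  · rw [opp_sideIndex]
    exact sideIndex_lt _
  · rw [opp_sideIndex, opp_sideIndex, M.mate_mate]
  · have := M.vertex_eq_vertex (t := t) (s := s) rfl
    rw [h₀, opp_sideIndex, ← Prod.mk.eta (p := M.mate (t, s)), nx_sideIndex]
    split_ifs with hr
    · rw [if_pos hr] at this
      rw [vert_sideIndex, vert_sideIndex, this.1]
    · rw [if_neg hr] at this
      rw [vert_sideIndex, vert_sideIndex, this.1]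
  · have := M.vertex_eq_vertex (t := t) (s := s) rfl
    rw [h₁, opp_sideIndex, ← Prod.mk.eta (p := M.mate (t, s)), nx_sideIndex, nx_sideIndex]
    split_ifs with hr
    · rw [if_pos hr] at this
      rw [vert_sideIndex, vert_sideIndex, this.2]
    · rw [if_neg hr] at this
      rw [vert_sideIndex, vert_sideIndex, this.2]
  · rw [h₀, h₁]
    split_ifs
    · exact Or.inr ⟨rfl, rfl⟩
    · exact Or.inl ⟨rfl, rfl⟩

open Classical in
/-- The dual graph of a connected surface is connected. -/
theorem mem_of_connectedSpace [ConnectedSpace M.Space] (hn : 0 < n) {S : Set ℕ} (h0 : 0 ∈ S)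
    (hS : ∀ s < 3 * n, s / 3 ∈ S → M.opp s / 3 ∈ S) (t : ℕ) (ht : t < n) : t ∈ S := by
  have hS' : ∀ e : Fin n × Fin 3, (e.1 : ℕ) ∈ S → ((M.mate e).1 : ℕ) ∈ S := by
    intro e he
    have := hS (sideIndex e) (sideIndex_lt e)
    rw [opp_sideIndex, sideIndex_div, sideIndex_div] at this
    exact this he
  have hglue : ∀ p q, M.Glued p q → decide ((p.1 : ℕ) ∈ S) = decide ((q.1 : ℕ) ∈ S) := by
    rintro p q ⟨s, s', h, -⟩
    have h1 := hS' (p.1, s)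
    have h2 := hS' (q.1, s')
    rw [← h, M.mate_mate] at h2
    rw [h] at h1
    simp only [decide_eq_decide]
    refine ⟨h1, fun hq => h2 ?_⟩
    rw [h]
    exact hq
  -- Whether the triangle of a point belongs to `S` is invariant under gluing, so it descends to a
  -- continuous map to a discrete space, which is constant on a connected surface.
  let g : M.Space → Bool := Quot.lift (fun p => decide ((p.1 : ℕ) ∈ S)) hglue
  have hg : Continuous g := by
    refine continuous_quot_lift _ ?_
    exact (continuous_of_discreteTopology (f := fun i : Fin n => decide ((i : ℕ) ∈ S))).comp
      continuous_fst
  have := PreconnectedSpace.constant (inferInstance : PreconnectedSpace M.Space) hg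
    (x := M.vertex ⟨t, ht⟩ 0) (y := M.vertex ⟨0, hn⟩ 0)
  have h1 : decide (t ∈ S) = decide (0 ∈ S) := this
  simpa [h0] using h1

end TriangulatedSurface

/-! ### The whole program, and the result as a vertex-unfolding -/

/-- The whole program. -/
def unfold : Program :=
  nxLoop ⨟ glueLoop ⨟ (initSearch ⨟ explore (.const 0) ⨟ searchLoop) ⨟ typing ⨟ (initStack ⨟ layoutLoop)

theorem runs_unfold {W N n : ℕ} (M : TriangulatedSurface n) (S : TriangleShapes n)
    [ConnectedSpace M.Space] (hn : 0 < n) (hW : 3 * n ≤ W) (hN : 3 * n ≤ N) :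
    Runs W N unfold (inputMem M S) (fun m' => ∃ E cx cy c, (∀ t < n, t ∈ E) ∧
      Placed ((inputMem M S).real 0) M.vert (m'.real 1) (m'.real 2) E cx cy c) := by
  set m := inputMem M S with hm
  have i0 : m.nat 0 0 = n := by simp [hm, inputMem]
  have i1 : ∀ k < 3 * n, m.nat 1 k = M.opp k := by
    intro k hk
    simp [hm, inputMem, hk, TriangulatedSurface.opp, sideIndex]
  have i2 : ∀ e, m.nat 2 (sideIndex e) = if M.reversed e = true then 1 else 0 := by
    intro e
    simp [hm, inputMem, sideIndex_lt e, sideOfIndex_sideIndex]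
  -- The marks, the queue, the types and the stack height are never cleared; they rely on the zeros
  -- of the initial memory.
  have iz : ∀ a, 3 ≤ a → ∀ k, m.nat a k = 0 := by
    intro a ha k
    have h0 : a ≠ 0 := by omega
    have h1 : a ≠ 1 := by omega
    have h2 : a ≠ 2 := by omega
    simp [hm, inputMem, h0, h1, h2]
  have ho : ∀ s < 3 * n, M.opp s < 3 * n := by
    intro s hs
    rw [TriangulatedSurface.opp, dif_pos hs]
    exact sideIndex_lt _
  clear_value m
  refine Runs.seq (runs_nxLoop hW (by omega) i0 (iz 10 (by omega) 0)).frame ?_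
  rintro m₁ ⟨n3, f1, g1⟩
  have h1 : HasTables n M.opp m₁ := ⟨by rw [f1 0 (by decide), i0], by
    rw [f1 1 (by decide)]; exact i1, n3⟩
  refine Runs.seq (runs_glueLoop hW hN h1.size (fun k hk => h1.mate k hk ▸ ho k hk) n3).frame ?_
  rintro m₂ ⟨n13, f2, g2⟩
  have h2 : HasTables n M.opp m₂ := ⟨by rw [f2 0 (by decide), h1.size], by
    rw [f2 1 (by decide)]; exact h1.mate, by rw [f2 3 (by decide)]; exact n3⟩
  have hg : IsGluing n M.opp (m₂.nat 13) (m₂.nat 14) M.vert := by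
    refine M.isGluing (fun e => ?_) fun e => ?_
    · rw [(n13 _ (sideIndex_lt e)).1, f1 2 (by decide), h1.mate _ (sideIndex_lt e), i2]
      split_ifs <;> simp_all
    · rw [(n13 _ (sideIndex_lt e)).2, f1 2 (by decide), h1.mate _ (sideIndex_lt e), i2]
      split_ifs <;> simp_all
  refine Runs.seq (runs_search hn hW (by omega) h2 ho hg.opp_opp
    (fun k => by rw [f2 4 (by decide), f1 4 (by decide), iz 4 (by omega)])
    (fun k => by rw [f2 5 (by decide), f1 5 (by decide), iz 5 (by omega)])
    (fun S h0 hS => M.mem_of_connectedSpace hn h0 hS)).frame ?_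
  rintro m₃ ⟨⟨n5, hsurj⟩, f3, g3⟩
  have h3 : HasTables n M.opp m₃ := ⟨by rw [f3 0 (by decide), h2.size], by
    rw [f3 1 (by decide)]; exact h2.mate, by rw [f3 3 (by decide)]; exact h2.next⟩
  refine Runs.seq (runs_typing hn hW (by omega) h3 ho hg.opp_opp n5 rfl
    (fun k => by rw [f3 6 (by decide), f2 6 (by decide), f1 6 (by decide), iz 6 (by omega)])).frame ?_
  rintro m₄ ⟨n6, f4, g4⟩
  have h4 : HasTables n M.opp m₄ := ⟨by rw [f4 0 (by decide), h3.size], by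
    rw [f4 1 (by decide)]; exact h3.mate, by rw [f4 3 (by decide)]; exact h3.next⟩
  rw [← f4 5 (by decide)] at n5 hsurj n6
  have e13 : m₄.nat 13 = m₂.nat 13 := by rw [f4 13 (by decide), f3 13 (by decide)]
  have e14 : m₄.nat 14 = m₂.nat 14 := by rw [f4 14 (by decide), f3 14 (by decide)]
  have er : m₄.real 0 = m.real 0 := by
    rw [g4 0 (by decide), g3 0 (by decide), g2 0 (by decide), g1 0 (by decide)]
  refine (runs_layout hn hW (by omega) h4 (by rwa [e13, e14]) n5 n6 ?_ (len := m.real 0)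
    (fun k _ => by rw [er]) ?_).mono ?_
  · rw [f4 15 (by decide), f3 15 (by decide), f2 15 (by decide), f1 15 (by decide), iz 15 (by omega)]
  · intro k hk
    obtain ⟨t, s, rfl⟩ := TriangulatedSurface.eq_sideIndex hk
    have hr : ∀ e : Fin n × Fin 3, m.real 0 (sideIndex e) = S.len e.1 e.2 := by
      intro e
      simp [hm, inputMem, sideIndex_lt e, sideOfIndex_sideIndex]
    rw [nx_sideIndex, nx_sideIndex, hr, hr, hr, add_assoc]
    exact S.triangle_ineq t s
  · rintro m' ⟨E, cx, cy, c, hE, hP⟩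
    refine ⟨E, cx, cy, c, fun t ht => ?_, hP⟩
    obtain ⟨i, hi, rfl⟩ := hsurj t ht
    exact hE i hi

/-- A coordinate is an open map, so the interior of a closed half-plane is the open one, and
opposite open half-planes are disjoint. -/
theorem disjoint_interior_convexHull {A B : Set (EuclideanSpace ℝ (Fin 2))} {z : ℝ}
    (hA : ∀ p ∈ A, p 0 ≤ z) (hB : ∀ p ∈ B, z ≤ p 0) :
    Disjoint (interior (convexHull ℝ A)) (interior (convexHull ℝ B)) := by
  let f : EuclideanSpace ℝ (Fin 2) →L[ℝ] ℝ := EuclideanSpace.proj 0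
  have hsurj : Function.Surjective f := fun r => ⟨EuclideanSpace.single 0 r, by simp [f]⟩
  have hopen : IsOpenMap f := f.isOpenMap hsurj
  have h1 : convexHull ℝ A ⊆ f ⁻¹' Set.Iic z :=
    convexHull_min (fun p hp => hA p hp) ((convex_Iic z).linear_preimage f.toLinearMap)
  have h2 : convexHull ℝ B ⊆ f ⁻¹' Set.Ici z :=
    convexHull_min (fun p hp => hB p hp) ((convex_Ici z).linear_preimage f.toLinearMap)
  have h3 := interior_mono h1
  have h4 := interior_mono h2
  rw [← hopen.preimage_interior_eq_interior_preimage f.continuous, interior_Iic] at h3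
  rw [← hopen.preimage_interior_eq_interior_preimage f.continuous, interior_Ici] at h4
  rw [Set.disjoint_left]
  intro p hp hp'
  exact lt_asymm (show f p < z from h3 hp) (show z < f p from h4 hp')

theorem Placed.isVertexUnfolding {n : ℕ} {M : TriangulatedSurface n} {S : TriangleShapes n}
    {m : Mem} {E : Set ℕ} {cx cy : ℝ} {c : Option M.Space} (hE : ∀ t < n, t ∈ E)
    (h : Placed ((inputMem M S).real 0) M.vert (m.real 1) (m.real 2) E cx cy c) :
    IsVertexUnfolding M S (outputLayout n m) := by
  have hlen : ∀ e : Fin n × Fin 3, (inputMem M S).real 0 (sideIndex e) = S.len e.1 e.2 := by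
    intro e
    simp [inputMem, sideIndex_lt e, sideOfIndex_sideIndex]
  have h0 : ∀ t i, outputLayout n m t i 0 = m.real 1 (sideIndex (t, i)) := fun t i => rfl
  have h1 : ∀ t i, outputLayout n m t i 1 = m.real 2 (sideIndex (t, i)) := fun t i => rfl
  have hdiv : ∀ t i, sideIndex ((t, i) : Fin n × Fin 3) / 3 = t := fun t i => sideIndex_div (t, i)
  have hmem : ∀ t i, sideIndex ((t, i) : Fin n × Fin 3) / 3 ∈ E := fun t i => by
    rw [hdiv]
    exact hE _ t.2
  constructor
  · intro t s
    have hd := h.dist _ (hmem t s)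
    rw [nx_sideIndex, hlen] at hd
    have hpos : 0 ≤ S.len t s := by
      have k1 := S.triangle_ineq t (s + 1)
      have k2 := S.triangle_ineq t (s + 2)
      have e1 : s + 1 + 1 = s + 2 := by rw [add_assoc]; rfl
      have e2 : s + 1 + 2 = s := by rw [add_assoc]; simp
      have e3 : s + 2 + 1 = s := by rw [add_assoc]; simp
      have e4 : s + 2 + 2 = s + 1 := by rw [add_assoc]; rfl
      rw [e1, e2] at k1
      rw [e3, e4] at k2
      linarith
    rw [EuclideanSpace.dist_eq, Fin.sum_univ_two, h0, h0, h1, h1, Real.dist_eq, Real.dist_eq,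
      sq_abs, sq_abs, hd, Real.sqrt_sq hpos]
  · intro t
    have := h.ccw _ (hmem t 0)
    rw [nx_sideIndex, nx_sideIndex] at this
    simp only [h0, h1]
    exact this
  · intro t t' htt
    have hval : (t : ℕ) ≠ t' := fun h => htt (Fin.ext h)
    rcases h.strip t (hE _ t.2) t' (hE _ t'.2) hval with ⟨z, hz⟩ | ⟨z, hz⟩
    · refine disjoint_interior_convexHull (z := z) ?_ ?_
      · rintro _ ⟨i, rfl⟩
        exact (hz (sideIndex (t, i))).1 (hdiv t i)
      · rintro _ ⟨i, rfl⟩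
        exact (hz (sideIndex (t', i))).2 (hdiv t' i)
    · refine (disjoint_interior_convexHull (z := z) ?_ ?_).symm
      · rintro _ ⟨i, rfl⟩
        exact (hz (sideIndex (t', i))).1 (hdiv t' i)
      · rintro _ ⟨i, rfl⟩
        exact (hz (sideIndex (t, i))).2 (hdiv t i)
  · intro t t'
    have hchain := h.joined t (hE _ t.2) t' (hE _ t'.2)
    suffices ∀ r : ℕ, Relation.ReflTransGen (JoinedAt M.vert (m.real 1) (m.real 2) E) t r →
        ∀ hr : r < n, Relation.ReflTransGen ((outputLayout n m).Joined M) t ⟨r, hr⟩ from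
      this t' hchain t'.2
    intro r hr
    induction hr with
    | refl => exact fun _ => .refl
    | @tail r r' _ hj ih =>
      intro hr'
      obtain ⟨-, -, k, k', rfl, rfl, hv, hx, hy⟩ := hj
      have hk' : k' < 3 * n := by omega
      by_cases hk : k < 3 * n
      · refine (ih (by omega)).tail ?_
        obtain ⟨t₁, i, rfl⟩ := TriangulatedSurface.eq_sideIndex hk
        obtain ⟨t₂, i', rfl⟩ := TriangulatedSurface.eq_sideIndex hk'
        have e1 : (⟨sideIndex (t₁, i) / 3, by omega⟩ : Fin n) = t₁ := Fin.ext (hdiv t₁ i)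
        have e2 : (⟨sideIndex (t₂, i') / 3, by omega⟩ : Fin n) = t₂ := Fin.ext (hdiv t₂ i')
        rw [e1, e2]
        rw [M.vert_sideIndex, M.vert_sideIndex, Option.some_inj] at hv
        refine ⟨i, i', hv, ?_⟩
        ext j
        fin_cases j
        · exact hx
        · exact hy
      -- Numbers from `3 * n` on have vertex `none`, so no chain of joined triangles passes through
      -- a triangle that does not exist.
      · rw [TriangulatedSurface.vert, TriangulatedSurface.vert, dif_neg hk, dif_pos hk'] at hv
        cases hv

/-- Connectedness includes nonemptiness; without `0 < n` the additive part of the time bound could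
not be absorbed into `C * n`. -/
theorem pos_of_connectedSpace {n : ℕ} (M : TriangulatedSurface n) [ConnectedSpace M.Space] :
    0 < n := by
  obtain ⟨p⟩ : Nonempty M.Space := inferInstance
  induction p using Quot.ind with
  | mk p => exact p.1.pos

theorem exec_unfold {n : ℕ} (M : TriangulatedSurface n) (S : TriangleShapes n)
    [ConnectedSpace M.Space] : ∃ m T, Exec ((4 * unfold.maxCost + 3) * n) unfold (inputMem M S) m T ∧
      T ≤ (4 * unfold.maxCost + 3) * n ∧ IsVertexUnfolding M S (outputLayout n m) := by
  have hn := pos_of_connectedSpace M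
  -- The summand 3 in the constant makes room for the `3 * n` cells of the tables; the factor 4
  -- comes from `3 * n + 1 ≤ 4 * n`.
  have hW : 3 * n ≤ (4 * unfold.maxCost + 3) * n := Nat.mul_le_mul_right n (Nat.le_add_left _ _)
  obtain ⟨m, T, h1, h2, E, cx, cy, c, hE, hP⟩ := runs_unfold (N := 3 * n) M S hn hW le_rfl
  refine ⟨m, T, h1, h2.trans ?_, hP.isVertexUnfolding hE⟩
  calc unfold.maxCost * (3 * n + 1) ≤ unfold.maxCost * (4 * n) := Nat.mul_le_mul_left _ (by omega)
    _ = 4 * unfold.maxCost * n := by ring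
    _ ≤ (4 * unfold.maxCost + 3) * n := Nat.mul_le_mul_right n (Nat.le_add_right _ _)

end VertexUnfolding
end

theorem mainTheorem1 :
    (∀ (n : ℕ) (M : VertexUnfolding.TriangulatedSurface n) (S : VertexUnfolding.TriangleShapes n),
      ConnectedSpace M.Space →
        ∃ P : VertexUnfolding.Layout n, VertexUnfolding.IsVertexUnfolding M S P) ∧
    (∃ (prog : VertexUnfolding.Program) (C : ℕ),
      ∀ (n : ℕ) (M : VertexUnfolding.TriangulatedSurface n) (S : VertexUnfolding.TriangleShapes n),
        ConnectedSpace M.Space →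
          ∃ (m : VertexUnfolding.Mem) (T : ℕ),
            VertexUnfolding.Exec (C * n) prog (VertexUnfolding.inputMem M S) m T ∧
            T ≤ C * n ∧
            VertexUnfolding.IsVertexUnfolding M S (VertexUnfolding.outputLayout n m)) := by
  refine ⟨fun n M S _ => ?_, VertexUnfolding.unfold, 4 * VertexUnfolding.unfold.maxCost + 3,
    fun n M S _ => VertexUnfolding.exec_unfold M S⟩
  -- Existence is read off from the output of the program.
  obtain ⟨m, T, -, -, h⟩ := VertexUnfolding.exec_unfold M S
  exact ⟨_, h⟩
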